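/- **Definitions.** Let $F$ be a field. A depth-3 circuit in $n$ variables with top fan-in $k$ is $C=\sum_{i=1}^{k}a_i\prod_{j=1}^{n_i}\ell_{ij}$ with $a_i\in F$ and linear polynomials $\ell_{ij}=b_0+\sum_r b_rx_r$ over $F$; it is multilinear if the polynomial computed at every gate is multilinear. A partition of the variables is induced by the $i$-th product gate if two variables that occur in the $i$-th product have the same color (lie in the same part) exactly when they occur in the same factor $\ell_{ij}$; a variable that does not occur may have any color. A sequence $P_1,\dots,P_k$ of partitions of the variables has distance at most $\delta$ if for every $i\ge 2$ each color of $P_i$ belongs to a set of at most $\delta$ colors of $P_i$ whose union is, for every $j<i$, a union of colors of $P_j$. A circuit has $\delta$-distance if its product gates can be ordered so that they induce a sequence of partitions of distance at most $\delta$. Given a partition of the variables into $m$ base sets, $C$ has $\delta$-distance on the base sets if for each base set $B$ the circuit obtained from $C$ by substituting $0$ for all variables outside $B$ has $\delta$-distance (the order of the gates may depend on $B$). **Theorem.** Put $\ell_0=\lceil\log_2(k+1)\rceil$ and $\ell=\ell_0+\delta+1$. (1) There are a constant $c$ and a single program for a random access machine over a field (unit-cost addition, truncated subtraction and comparison of natural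 numbers, ring operations on field elements, access to a list of field elements) with the following property. Let $n,\delta,k\ge 1$, let a partition of the $n$ variables into $m$ base sets be given, and let $K$ be a field with a list of elements whose first $(n+1)^{c\,\delta\,\ell_0}$ entries are distinct. On the input $n,m,\delta,k$ and the base sets, the program halts within $(n+1)^{c\,m\,\delta\,\ell_0}=n^{O(m\delta\log k)}$ steps (the equality for $n,k\ge 2$) and prints a list $H$ of points of $K^n$ such that, for every subfield $F$ of $K$, every multilinear depth-3 circuit $C$ over $F$ with top fan-in $k$ that has $\delta$-distance on the given base sets and computes a nonzero polynomial satisfies $C(x)\ne 0$ for some $x\in H$. (2) Let $C$ be a multilinear depth-3 circuit over a field $F$ with top fan-in $k\ge1$ that has $\delta$-distance, $\delta\ge1$, on $m$ given base sets, and let $D=\bigl(\prod_j\ell_{ij}\bigr)_{i=1}^{k}$. Take a separate shift variable $t_b$ for each base set $b$, and exponents $w_r\ge 0$ such that, within each base set, distinct sets $S$ of at most $\delta\ell_0$ variables have distinct sums $\sum_{r\in S}w_r$. Then the polynomial vector $D'$ obtained from $D$ by replacing every $x_r$ by $x_r+t_b^{w_r}$, where $b$ is the base set of $x_r$, is $(m(\ell-1)+1)$-concentrated: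 over $F(t_1,\dots,t_m)$, the coefficient vectors in $D'$ of the multilinear monomials in fewer than $m(\ell-1)+1$ variables have the same rank as the coefficient vectors of all multilinear monomials. -/

import Mathlib

universe u v

/-! ### Depth-3 circuits -/

/-- A linear polynomial `b₀ + ∑ r, b r * x r` in the variables `x₀, …, xₙ₋₁`. -/
structure LinForm (F : Type*) (n : ℕ) where
  const : F
  coef : Fin n → F

namespace LinForm

variable {F : Type*} [Field F] {n : ℕ}

noncomputable def poly (p : LinForm F n) : MvPolynomial (Fin n) F :=
  MvPolynomial.C p.const + ∑ r, MvPolynomial.C (p.coef r) * MvPolynomial.X r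

/-- The variable `x r` is present in the linear polynomial. -/
def Present (p : LinForm F n) (r : Fin n) : Prop := p.coef r ≠ 0

open Classical in
/-- Substitute `0` for all variables outside `B`. -/
noncomputable def restrict (p : LinForm F n) (B : Set (Fin n)) : LinForm F n where
  const := p.const
  coef r := if r ∈ B then p.coef r else 0

end LinForm

/-- A depth-3 circuit `∑ i, a i * ∏ j, ℓ i j` in `n` variables with top fan-in `k`; the `i`-th
product gate has fan-in `fanin i`. -/
structure Depth3Circuit (F : Type*) (n k : ℕ) where
  weight : Fin k → F
  fanin : Fin k → ℕ
  lin : (i : Fin k) → Fin (fanin i) → LinForm F n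

/-- The distance of the sequence `P 0, …, P (k - 1)` of partitions of the variables is at most
`δ`: every color `Y` of a partition lies in a set `N` of at most `δ` colors of that partition whose
union is, for every earlier partition, a union of colors of that earlier partition. -/
def PartitionDistLE {n k : ℕ} (P : Fin k → Finpartition (Finset.univ : Finset (Fin n)))
    (δ : ℕ) : Prop :=
  ∀ i : Fin k, 0 < (i : ℕ) → ∀ Y ∈ (P i).parts,
    ∃ N ⊆ (P i).parts, Y ∈ N ∧ N.card ≤ δ ∧
      ∀ j < i, ∃ Z ⊆ (P j).parts, Z.sup id = N.sup id

namespace Depth3Circuit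

variable {F : Type*} [Field F] {n k : ℕ}

/-- The polynomial computed at the `i`-th product gate. -/
noncomputable def gate (Q : Depth3Circuit F n k) (i : Fin k) : MvPolynomial (Fin n) F :=
  ∏ j, (Q.lin i j).poly

/-- The polynomial computed by the circuit. -/
noncomputable def poly (Q : Depth3Circuit F n k) : MvPolynomial (Fin n) F :=
  ∑ i, MvPolynomial.C (Q.weight i) * Q.gate i

/-- The polynomial computed at every gate (bottom sums, products, output) is multilinear. -/
def IsMultilinear (Q : Depth3Circuit F n k) : Prop :=
  (∀ i j r, (Q.lin i j).poly.degreeOf r ≤ 1) ∧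
    (∀ i r, (Q.gate i).degreeOf r ≤ 1) ∧ ∀ r, Q.poly.degreeOf r ≤ 1

/-- The partition `P` is induced by the `i`-th product gate: variables that are present at the gate
have the same color exactly when they are present in the same linear factor. A variable that is
absent from the gate may be given any color (it may be added to a factor, or to the
factor `1`, with coefficient `0`). -/
def Induces (Q : Depth3Circuit F n k) (i : Fin k)
    (P : Finpartition (Finset.univ : Finset (Fin n))) : Prop :=
  ∀ j j' r r', (Q.lin i j).Present r → (Q.lin i j').Present r' →
    (P.part r = P.part r' ↔ j = j')

/-- The product gates can be ordered so that they induce a partition sequence of distance at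
most `δ`. -/
def HasDistance (Q : Depth3Circuit F n k) (δ : ℕ) : Prop :=
  ∃ (e : Equiv.Perm (Fin k)) (P : Fin k → Finpartition (Finset.univ : Finset (Fin n))),
    (∀ i, Q.Induces (e i) (P i)) ∧ PartitionDistLE P δ

/-- The circuit with `0` substituted for all variables outside `B`. -/
noncomputable def restrict (Q : Depth3Circuit F n k) (B : Set (Fin n)) :
    Depth3Circuit F n k where
  weight := Q.weight
  fanin := Q.fanin
  lin i j := (Q.lin i j).restrict B

/-- The circuit has `δ`-distance on each of the `m` base sets `{r | base r = b}`, `b < m`. The order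
of the gates may depend on the base set. -/
def HasBaseSetsDistance {m : ℕ} (Q : Depth3Circuit F n k) (base : Fin n → Fin m) (δ : ℕ) : Prop :=
  ∀ b, (Q.restrict {r | base r = b}).HasDistance δ

/-- The field of rational functions in the shift variables `t₀, …, tₘ₋₁`. -/
abbrev ShiftField (F : Type*) [Field F] (m : ℕ) : Type _ :=
  FractionRing (MvPolynomial (Fin m) F)

/-- The `i`-th coordinate of `D(x + φ(t))`, where `D` is the vector of product gates and the shift
of `x r` is the `w r`-th power of the shift variable of the base set of `x r`. -/
noncomputable def shiftedGate {m : ℕ} (Q : Depth3Circuit F n k) (base : Fin n → Fin m)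
    (w : Fin n → ℕ) (i : Fin k) : MvPolynomial (Fin n) (ShiftField F m) :=
  MvPolynomial.aeval
    (fun r => MvPolynomial.X r + MvPolynomial.C
      (algebraMap (MvPolynomial (Fin m) F) (ShiftField F m) (MvPolynomial.X (base r) ^ w r)))
    (Q.gate i)

end Depth3Circuit

/-- The coefficient vector of the monomial `∏ r ∈ S, x r` in a vector of `k` polynomials. -/
noncomputable def coefVec {L : Type*} [Field L] {n k : ℕ} (D : Fin k → MvPolynomial (Fin n) L)
    (S : Finset (Fin n)) : Fin k → L :=
  fun i => (D i).coeff (∑ r ∈ S, Finsupp.single r 1)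

/-- `ℓ`-concentration: the coefficient vectors of the multilinear monomials of support less
than `ℓ` have the same rank as those of all multilinear monomials. -/
def IsConcentrated {L : Type*} [Field L] {n k : ℕ} (D : Fin k → MvPolynomial (Fin n) L)
    (ℓ : ℕ) : Prop :=
  Set.finrank L {u | ∃ S : Finset (Fin n), S.card < ℓ ∧ coefVec D S = u} =
    Set.finrank L {u | ∃ S : Finset (Fin n), coefVec D S = u}

/-- Within each base set, the weights `w` separate the multilinear monomials of support at
most `s`. -/
def SeparatesBaseSets {n m : ℕ} (base : Fin n → Fin m) (w : Fin n → ℕ) (s : ℕ) : Prop :=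
  ∀ b, ∀ S T : Finset (Fin n), (∀ r ∈ S, base r = b) → (∀ r ∈ T, base r = b) →
    S.card ≤ s → T.card ≤ s → ∑ r ∈ S, w r = ∑ r ∈ T, w r → S = T

/-! ### Random access machines over a field

Structured programs for a unit-cost random access machine with one memory for natural numbers and
one memory for field elements. On natural numbers there are only constants, addition, truncated
subtraction, comparison and indirect addressing (no multiplication, so that unit cost is
realistic). On field elements there are `0`, `1`, the ring operations and access to a given list
`elem 0, elem 1, …` of field elements. A program is a finite text that does not mention the
field. -/

namespace FieldRAM

/-- Expressions of natural-number type; `read a` is the content of the cell with address `a`. -/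
inductive NExp where
  | const (c : ℕ)
  | read (a : NExp)
  | add (a b : NExp)
  | sub (a b : NExp)

/-- Expressions of field type; `read a` is the content of the field cell with address `a`. -/
inductive FExp where
  | zero
  | one
  | read (a : NExp)
  | elem (a : NExp)
  | neg (x : FExp)
  | add (x y : FExp)
  | mul (x y : FExp)

/-- Programs. The tests of `ite` and `while` are `a < b`. -/
inductive Prog where
  | skip
  | setN (a e : NExp)
  | setF (a : NExp) (x : FExp)
  | emit (x : FExp)
  | seq (p q : Prog)
  | ite (a b : NExp) (p q : Prog)
  | while (a b : NExp) (p : Prog)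

structure State (K : Type*) where
  mem : ℕ → ℕ
  fmem : ℕ → K
  out : List K

namespace NExp

def eval (mem : ℕ → ℕ) : NExp → ℕ
  | const c => c
  | read a => mem (a.eval mem)
  | add a b => a.eval mem + b.eval mem
  | sub a b => a.eval mem - b.eval mem

/-- One step for every node of the expression. -/
def cost : NExp → ℕ
  | const _ => 1
  | read a => a.cost + 1
  | add a b => a.cost + b.cost + 1
  | sub a b => a.cost + b.cost + 1

end NExp

namespace FExp

def eval {K : Type*} [Field K] (elem : ℕ → K) (s : State K) : FExp → K
  | zero => 0
  | one => 1
  | read a => s.fmem (a.eval s.mem)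
  | .elem a => elem (a.eval s.mem)
  | neg x => - x.eval elem s
  | add x y => x.eval elem s + y.eval elem s
  | mul x y => x.eval elem s * y.eval elem s

/-- One step for every node of the expression. -/
def cost : FExp → ℕ
  | zero => 1
  | one => 1
  | read a => a.cost + 1
  | .elem a => a.cost + 1
  | neg x => x.cost + 1
  | add x y => x.cost + y.cost + 1
  | mul x y => x.cost + y.cost + 1

end FExp

/-- `Exec elem p s t s'`: started in the state `s`, the program `p` halts after exactly `t` steps in
the state `s'`. -/
inductive Exec {K : Type*} [Field K] (elem : ℕ → K) : Prog → State K → ℕ → State K → Prop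
  | skip (s) : Exec elem .skip s 1 s
  | setN (a e s) : Exec elem (.setN a e) s (a.cost + e.cost + 1)
      { s with mem := Function.update s.mem (a.eval s.mem) (e.eval s.mem) }
  | setF (a x s) : Exec elem (.setF a x) s (a.cost + x.cost + 1)
      { s with fmem := Function.update s.fmem (a.eval s.mem) (x.eval elem s) }
  | emit (x s) : Exec elem (.emit x) s (x.cost + 1) { s with out := s.out ++ [x.eval elem s] }
  | seq {p q s t s' t' s''} : Exec elem p s t s' → Exec elem q s' t' s'' →
      Exec elem (.seq p q) s (t + t' + 1) s''
  | ite_true {a b p q s t s'} : a.eval s.mem < b.eval s.mem → Exec elem p s t s' →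
      Exec elem (.ite a b p q) s (a.cost + b.cost + t + 1) s'
  | ite_false {a b p q s t s'} : ¬ a.eval s.mem < b.eval s.mem → Exec elem q s t s' →
      Exec elem (.ite a b p q) s (a.cost + b.cost + t + 1) s'
  | while_true {a b p s t s' t' s''} : a.eval s.mem < b.eval s.mem → Exec elem p s t s' →
      Exec elem (.while a b p) s' t' s'' →
      Exec elem (.while a b p) s (a.cost + b.cost + t + t' + 1) s''
  | while_false {a b p s} : ¬ a.eval s.mem < b.eval s.mem →
      Exec elem (.while a b p) s (a.cost + b.cost + 1) s

/-- The initial state on the input `n, m, δ, k` and the base sets: these four numbers are in the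
cells `0, 1, 2, 3`, the cell `4 + r` holds the number of the base set of the variable `x r`, and
everything else is `0`. -/
def initState (K : Type*) [Field K] {n m : ℕ} (δ k : ℕ) (base : Fin n → Fin m) : State K where
  mem a :=
    if a = 0 then n else if a = 1 then m else if a = 2 then δ else if a = 3 then k
    else if h : a - 4 < n then (base ⟨a - 4, h⟩ : ℕ) else 0
  fmem _ := 0
  out := []

/-- Started on the given input, the program `p` halts after exactly `t` steps, having written
the points of the list `H`, coordinate by coordinate. -/
def Prints {K : Type*} [Field K] (elem : ℕ → K) (p : Prog) {n m : ℕ} (δ k : ℕ)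
    (base : Fin n → Fin m) (t : ℕ) (H : List (Fin n → K)) : Prop :=
  ∃ s : State K, Exec elem p (initState K δ k base) t s ∧ s.out = H.flatMap List.ofFn

end FieldRAM

/-! Concentration is proved in dual form: a combination of the shifted gates with coefficients in
`F[t₁, …, tₘ]` is zero as soon as its coefficients on monomials of at most `m(ℓ - 1)` variables
vanish (`eq_zero_of_forall_support_card_le`). A linear functional that separates a coefficient
vector from the span of the low ones yields such a combination after clearing denominators.

The engine is a rank argument in one shift variable `X` (`eq_zero_of_shift_rank_lt`). Suppose a
nonzero combination of `k < 2 ^ l` shifted gates has only monomials with at least `l` variables.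
Undoing the shift gives a combination of `k` polynomials whose coefficients are free of `X`. Scaling
each variable by its shift turns this into a shift by constants, and a nonzero multilinear
polynomial without monomials of fewer than `l` variables acquires at least `2 ^ l` monomials under
such a shift (`two_pow_le_card_upper_sum`). Applied to the part of top degree in `X`, this gives at
least `2 ^ l` coefficients of the unshifted combination whose degrees in `X` are pairwise distinct,
because the weights separate. But these coefficients come from more than `k` vectors of length `k`
under one linear map, so they satisfy a linear relation over the `X`-free ring: a contradiction.

The argument needs separation only on the monomials that occur, so these must have at most `δl`
variables. `eq_zero_of_forall_card_le` reduces to this case. Consider the joins of the first `q`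
partitions. If some monomial has `δ + 1` variables in one block of a join, the distance hypothesis
puts two of them into one factor of each later gate; multiples of these variables therefore see only
the earlier gates, for which the blocks are still thin. Freezing all but at most `l` blocks leaves
monomials with between `l` and `δl` variables. Several base sets are treated one at a time, the
other shift variables being constants.

For the hitting set, a modulus `q` of size `n ^ O(δ log k)` makes the weights `2 ^ r % q`
separating. A nonzero shifted polynomial has a nonzero coefficient of minimal support; it is the
value at the indicator of that support, and a grid of values for the shift variables keeps it
nonzero. The program runs through all moduli, grid points and supports, coded as digits of one
number. -/

/-! ### Coefficients of products of affine forms -/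

namespace AffineProduct

open MvPolynomial

section Ring

variable {A : Type*} [CommRing A] {n : ℕ}

/-- The affine form `u + ∑ r, β r * x r`. -/
noncomputable def affine (u : A) (β : Fin n → A) : MvPolynomial (Fin n) A :=
  C u + ∑ r, C (β r) * X r

/-- The coefficient of the multilinear monomial `∏ r ∈ S, x r`. -/
noncomputable def setCoeff (S : Finset (Fin n)) (p : MvPolynomial (Fin n) A) : A :=
  p.coeff (∑ r ∈ S, Finsupp.single r 1)

theorem sum_single_apply (S : Finset (Fin n)) (a : Fin n) :
    (∑ r ∈ S, Finsupp.single r 1 : Fin n →₀ ℕ) a = if a ∈ S then 1 else 0 := by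
  simp [Finsupp.finsetSum_apply, Finsupp.single_apply]

theorem sum_single_injective :
    Function.Injective (fun S : Finset (Fin n) => (∑ r ∈ S, Finsupp.single r 1 : Fin n →₀ ℕ)) := by
  intro S T h
  ext a
  have := DFunLike.congr_fun h a
  simp only [sum_single_apply] at this
  by_cases h1 : a ∈ S <;> by_cases h2 : a ∈ T <;> simp_all

theorem setCoeff_sum {ι : Type*} (S : Finset (Fin n)) (I : Finset ι)
    (p : ι → MvPolynomial (Fin n) A) : setCoeff S (∑ i ∈ I, p i) = ∑ i ∈ I, setCoeff S (p i) := by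
  simp [setCoeff, coeff_sum]

theorem setCoeff_C_mul (S : Finset (Fin n)) (a : A) (p : MvPolynomial (Fin n) A) :
    setCoeff S (C a * p) = a * setCoeff S p := by
  simp [setCoeff]

theorem setCoeff_map {A' : Type*} [CommRing A'] (f : A →+* A') (S : Finset (Fin n))
    (p : MvPolynomial (Fin n) A) : setCoeff S (map f p) = f (setCoeff S p) := by
  simp [setCoeff, coeff_map]

theorem map_affine {A' : Type*} [CommRing A'] (f : A →+* A') (u : A) (β : Fin n → A) :
    map f (affine u β) = affine (f u) (fun r => f (β r)) := by
  simp [affine]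

theorem setCoeff_X_mul (S : Finset (Fin n)) (r : Fin n) (p : MvPolynomial (Fin n) A) :
    setCoeff S (X r * p) = if r ∈ S then setCoeff (S.erase r) p else 0 := by
  classical
  rw [setCoeff, coeff_X_mul']
  have hs : r ∈ (∑ r ∈ S, Finsupp.single r 1 : Fin n →₀ ℕ).support ↔ r ∈ S := by
    rw [Finsupp.mem_support_iff, sum_single_apply]; simp
  by_cases h : r ∈ S
  · rw [if_pos h, if_pos (hs.2 h), setCoeff, ← Finset.add_sum_erase _ _ h, add_tsub_cancel_left]
  · rw [if_neg h, if_neg (mt hs.1 h)]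

theorem setCoeff_affine_mul (S : Finset (Fin n)) (u : A) (β : Fin n → A)
    (p : MvPolynomial (Fin n) A) :
    setCoeff S (affine u β * p) = u * setCoeff S p + ∑ r ∈ S, β r * setCoeff (S.erase r) p := by
  classical
  have : affine u β * p = C u * p + ∑ r, C (β r) * (X r * p) := by
    rw [affine, add_mul, Finset.sum_mul]; simp only [mul_assoc]
  have hadd : setCoeff S (C u * p + ∑ r, C (β r) * (X r * p)) =
      setCoeff S (C u * p) + setCoeff S (∑ r, C (β r) * (X r * p)) := by
    simp only [setCoeff, coeff_add]
  rw [this, hadd, setCoeff_sum, setCoeff_C_mul]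
  congr 1
  simp only [setCoeff_C_mul, setCoeff_X_mul, mul_ite, mul_zero]
  rw [Finset.sum_ite_mem, Finset.univ_inter]

theorem setCoeff_one (S : Finset (Fin n)) :
    setCoeff S (1 : MvPolynomial (Fin n) A) = if S = ∅ then 1 else 0 := by
  classical
  rw [setCoeff, coeff_one]
  congr 1
  rw [eq_iff_iff]
  constructor
  · intro h; exact sum_single_injective (by simpa using h.symm)
  · rintro rfl; simp

variable {ι : Type*} {u : ι → A} {β : ι → Fin n → A}

theorem setCoeff_prod_of_absent {J : Finset ι} {S : Finset (Fin n)} {r : Fin n} (hr : r ∈ S)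
    (h : ∀ j ∈ J, β j r = 0) : setCoeff S (∏ j ∈ J, affine (u j) (β j)) = 0 := by
  classical
  induction J using Finset.induction_on generalizing S with
  | empty => rw [Finset.prod_empty, setCoeff_one, if_neg (Finset.ne_empty_of_mem hr)]
  | insert a J ha ih =>
    rw [Finset.prod_insert ha, setCoeff_affine_mul, ih hr fun j hj => h j (by simp [hj]), mul_zero,
      zero_add]
    refine Finset.sum_eq_zero fun r' _ => ?_
    by_cases hrr : r' = r
    · rw [hrr, h a (by simp), zero_mul]
    · rw [ih (Finset.mem_erase.2 ⟨Ne.symm hrr, hr⟩) fun j hj => h j (by simp [hj]), mul_zero]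

theorem setCoeff_affine_mul_of_absent {S : Finset (Fin n)} {a : A} {b : Fin n → A}
    (h : ∀ r ∈ S, b r = 0) (p : MvPolynomial (Fin n) A) :
    setCoeff S (affine a b * p) = a * setCoeff S p := by
  rw [setCoeff_affine_mul, Finset.sum_eq_zero fun r hr => by rw [h r hr, zero_mul], add_zero]

/-- Factors that contain no variable of `U` contribute only their constants to the coefficients of
monomials in the variables of `U`. -/
theorem setCoeff_prod_filter [DecidableEq ι] (J : Finset ι) (U : Set (Fin n))
    (hd : DecidablePred fun j => ∃ r ∈ U, β j r ≠ 0)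
    {T : Finset (Fin n)} (hT : (T : Set (Fin n)) ⊆ U) :
    setCoeff T (∏ j ∈ J, affine (u j) (β j)) =
      (∏ j ∈ J with ¬ ∃ r ∈ U, β j r ≠ 0, u j) *
        setCoeff T (∏ j ∈ J with ∃ r ∈ U, β j r ≠ 0, affine (u j) (β j)) := by
  rw [← Finset.prod_filter_mul_prod_filter_not J (fun j => ∃ r ∈ U, β j r ≠ 0), mul_comm]
  generalize (∏ j ∈ J with ∃ r ∈ U, β j r ≠ 0, affine (u j) (β j)) = p
  have key : ∀ J' : Finset ι, (∀ j ∈ J', ¬ ∃ r ∈ U, β j r ≠ 0) →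
      setCoeff T ((∏ j ∈ J', affine (u j) (β j)) * p) = (∏ j ∈ J', u j) * setCoeff T p := by
    intro J'
    induction J' using Finset.induction_on with
    | empty => simp
    | insert a J' ha ih =>
      intro h
      rw [Finset.prod_insert ha, Finset.prod_insert ha, mul_assoc, setCoeff_affine_mul_of_absent,
        ih fun j hj => h j (by simp [hj]), mul_assoc]
      intro r hr
      by_contra hb
      exact h a (by simp) ⟨r, hT hr, hb⟩
  exact key _ fun j hj => (Finset.mem_filter.1 hj).2

/-- Every variable occurs in at most one of the forms. -/
def ReadOnce (J : Finset ι) (β : ι → Fin n → A) : Prop :=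
  ∀ j ∈ J, ∀ j' ∈ J, ∀ r, β j r ≠ 0 → β j' r ≠ 0 → j = j'

theorem ReadOnce.mono {J J' : Finset ι} (h : ReadOnce J β) (hJ : J' ⊆ J) : ReadOnce J' β :=
  fun j hj j' hj' => h j (hJ hj) j' (hJ hj')

/-- Only the form `j` contains `z`, so it must contribute `z` and can contribute nothing else. -/
theorem setCoeff_insert_prod [DecidableEq ι] {J : Finset ι} {j : ι} (hj : j ∈ J) {z : Fin n}
    {T : Finset (Fin n)} (hz : z ∉ T) (h : ∀ j' ∈ J.erase j, β j' z = 0) :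
    setCoeff (insert z T) (∏ j ∈ J, affine (u j) (β j)) =
      β j z * setCoeff T (∏ j ∈ J.erase j, affine (u j) (β j)) := by
  rw [← Finset.mul_prod_erase _ _ hj, setCoeff_affine_mul,
    setCoeff_prod_of_absent (Finset.mem_insert_self z T) h, mul_zero, zero_add,
    Finset.sum_insert hz, Finset.erase_insert hz, Finset.sum_eq_zero, add_zero]
  intro r hr
  rw [setCoeff_prod_of_absent (r := z) _ h, mul_zero]
  exact Finset.mem_erase.2 ⟨fun e => hz (e ▸ hr), Finset.mem_insert_self z T⟩

open Classical in
/-- The coefficient of `x^Z * x^T` is, up to a factor that depends on `Z` alone, the coefficient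
of `x^T` in the product of those forms that contain no variable of `Z`. -/
theorem exists_setCoeff_union_prod {J : Finset ι} (h : ReadOnce J β) (Z : Finset (Fin n)) :
    ∃ ε : A, ∀ T, Disjoint Z T → setCoeff (Z ∪ T) (∏ j ∈ J, affine (u j) (β j)) =
      ε * setCoeff T (∏ j ∈ J with ∀ r ∈ Z, β j r = 0, affine (u j) (β j)) := by
  induction Z using Finset.induction_on generalizing J with
  | empty => exact ⟨1, by simp⟩
  | insert z Z hz ih =>
    -- If one form contains `z`, it is used up and leaves the product; if none does, every such
    -- coefficient is zero and `ε = 0` serves.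
    by_cases hp : ∃ j ∈ J, β j z ≠ 0
    · obtain ⟨j, hj, hjz⟩ := hp
      have h0 : ∀ j' ∈ J.erase j, β j' z = 0 := by
        intro j' hj'
        by_contra hne
        exact (Finset.ne_of_mem_erase hj') (h j' (Finset.mem_of_mem_erase hj') j hj z hne hjz)
      obtain ⟨ε, hε⟩ := ih (h.mono (Finset.erase_subset j J))
      refine ⟨β j z * ε, fun T hT => ?_⟩
      rw [Finset.disjoint_insert_left] at hT
      rw [Finset.insert_union, setCoeff_insert_prod hj (by simp [hz, hT.1]) h0, hε T hT.2, mul_assoc]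
      congr 4
      ext j'
      simp only [Finset.mem_filter, Finset.mem_erase, Finset.mem_insert, forall_eq_or_imp]
      constructor
      · rintro ⟨⟨h1, h2⟩, h3⟩
        exact ⟨h2, h0 j' (Finset.mem_erase.2 ⟨h1, h2⟩), h3⟩
      · rintro ⟨h2, h1, h3⟩
        exact ⟨⟨fun e => hjz (e ▸ h1), h2⟩, h3⟩
    · push Not at hp
      refine ⟨0, fun T _ => ?_⟩
      rw [zero_mul, setCoeff_prod_of_absent (r := z) (by simp) hp]

/-- A form that contains two variables of `S` makes the coefficient of `x^S` vanish. -/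
theorem setCoeff_prod_of_two {J : Finset ι} (h : ReadOnce J β) {S : Finset (Fin n)} {r r' : Fin n}
    (hr : r ∈ S) (hr' : r' ∈ S) (hne : r ≠ r')
    (hJ : ∀ j ∈ J, β j r' ≠ 0 → β j r ≠ 0) :
    setCoeff S (∏ j ∈ J, affine (u j) (β j)) = 0 := by
  classical
  obtain ⟨ε, hε⟩ := exists_setCoeff_union_prod (u := u) h {r}
  have hS : S = {r} ∪ S.erase r := by
    rw [← Finset.insert_eq, Finset.insert_erase hr]
  rw [hS, hε _ (by simp), setCoeff_prod_of_absent (r := r') (by simp [hr', hne.symm]), mul_zero]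
  intro j hj
  rw [Finset.mem_filter] at hj
  by_contra hb
  exact hJ j hj.1 hb (hj.2 r (by simp))

/-- Only multilinear monomials occur. -/
def Multilin (p : MvPolynomial (Fin n) A) : Prop :=
  ∀ m, p.coeff m ≠ 0 → ∀ r, m r ≤ 1

theorem multilin_iff_degreeOf {p : MvPolynomial (Fin n) A} :
    Multilin p ↔ ∀ r, p.degreeOf r ≤ 1 := by
  simp only [Multilin, degreeOf_le_iff, mem_support_iff]
  tauto

theorem Multilin.sum {κ : Type*} {I : Finset κ} {p : κ → MvPolynomial (Fin n) A}
    (h : ∀ i ∈ I, Multilin (p i)) : Multilin (∑ i ∈ I, p i) := by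
  intro m hm
  rw [coeff_sum] at hm
  obtain ⟨i, hi, hne⟩ := Finset.exists_ne_zero_of_sum_ne_zero hm
  exact h i hi m hne

theorem Multilin.C_mul {p : MvPolynomial (Fin n) A} (h : Multilin p) (a : A) :
    Multilin (C a * p) := by
  intro m hm
  rw [coeff_C_mul] at hm
  exact h m (right_ne_zero_of_mul hm)

open Classical in
theorem degreeOf_affine_le (a : A) (b : Fin n → A) (r : Fin n) :
    (affine a b).degreeOf r ≤ if b r = 0 then 0 else 1 := by
  rw [affine]
  refine (degreeOf_add_le _ _ _).trans (max_le (by simp) ?_)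
  refine (degreeOf_sum_le _ _ _).trans (Finset.sup_le fun r' _ => ?_)
  by_cases hr : r' = r
  · subst hr
    split_ifs with hb
    · simp [hb]
    · have : Nontrivial A := ⟨_, _, hb⟩
      exact (degreeOf_C_mul_le _ _ _).trans (by simp)
  · refine (degreeOf_C_mul_le _ _ _).trans ?_
    rw [degreeOf_X_of_ne (Ne.symm hr)]
    exact Nat.zero_le _

theorem multilin_prod {J : Finset ι} (h : ReadOnce J β) :
    Multilin (∏ j ∈ J, affine (u j) (β j)) := by
  classical
  rw [multilin_iff_degreeOf]
  intro r
  refine (degreeOf_prod_le r J _).trans ((Finset.sum_le_sum fun j _ =>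
    degreeOf_affine_le (u j) (β j) r).trans ?_)
  by_cases hp : ∃ j ∈ J, β j r ≠ 0
  · obtain ⟨j, hj, hjr⟩ := hp
    rw [Finset.sum_eq_single_of_mem j hj]
    · split_ifs <;> simp
    · intro j' hj' hne
      rw [if_pos]
      by_contra hb
      exact hne (h j' hj' j hj r hb hjr)
  · push Not at hp
    rw [Finset.sum_eq_zero fun j hj => if_pos (hp j hj)]
    exact zero_le_one

theorem Multilin.eq_sum {p : MvPolynomial (Fin n) A} (h : Multilin p) :
    p = ∑ S, C (setCoeff S p) * ∏ r ∈ S, X r := by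
  classical
  have hmon : ∀ (S : Finset (Fin n)) (a : A), C a * ∏ r ∈ S, X r =
      monomial (∑ r ∈ S, Finsupp.single r 1) a := by
    intro S a
    have : (∏ r ∈ S, X r : MvPolynomial (Fin n) A) =
        monomial (∑ r ∈ S, Finsupp.single r 1) 1 := by
      rw [monomial_sum_one]; rfl
    rw [this, C_mul_monomial, mul_one]
  simp only [hmon]
  ext m
  rw [coeff_sum]
  simp only [coeff_monomial]
  by_cases hm : ∃ S : Finset (Fin n), (∑ r ∈ S, Finsupp.single r 1 : Fin n →₀ ℕ) = m
  · obtain ⟨S, rfl⟩ := hm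
    rw [Finset.sum_eq_single S, if_pos rfl, setCoeff]
    · intro T _ hne
      rw [if_neg fun e => hne (sum_single_injective e)]
    · simp
  · rw [Finset.sum_eq_zero fun S _ => if_neg fun e => hm ⟨S, e⟩]
    by_contra hne
    refine hm ⟨m.support, ?_⟩
    ext a
    rw [sum_single_apply]
    have := h m hne a
    split_ifs with hs
    · rw [Finsupp.mem_support_iff] at hs; omega
    · rw [Finsupp.notMem_support_iff] at hs; omega

end Ring

end AffineProduct

/-! ### Supports of shifted multilinear polynomials and their rank -/

namespace AffineProduct

section Count

variable {α G : Type*} [DecidableEq α] [AddCommGroup G]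

open Classical in
/-- A nonzero multilinear polynomial, all of whose monomials have at least `d` variables, has at
least `2 ^ d` monomials after the shift of all variables by `1`. -/
theorem two_pow_le_card_upper_sum (V : Finset α) (d : ℕ) (e : Finset α → G)
    (hd : ∀ S ⊆ V, e S ≠ 0 → d ≤ S.card) (hne : ∃ S ⊆ V, e S ≠ 0) :
    2 ^ d ≤ (V.powerset.filter fun T => ∑ S ∈ V.powerset, (if T ⊆ S then e S else 0) ≠ 0).card := by
  induction V using Finset.induction_on generalizing d e with
  | empty =>
    obtain ⟨S, hS, hne⟩ := hne
    obtain rfl := Finset.subset_empty.1 hS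
    have := hd ∅ le_rfl hne
    simp only [Finset.card_empty, nonpos_iff_eq_zero] at this
    simp [this, hne, Finset.filter_singleton]
  | insert x V hx ih =>
    -- Writing `p = p₀ + x p₁`, the shift of `x` gives `(p₀ + p₁) + x p₁`; `b` and `a` are the two
    -- parts. If both are nonzero, each contributes `2 ^ (d - 1)`; if one vanishes, the other still
    -- has all monomials of size at least `d`.
    set a : Finset α → G := fun S => e (insert x S) with ha
    set b : Finset α → G := fun S => e S + e (insert x S) with hb
    have hcard : ((insert x V).powerset.filter fun T =>
          ∑ S ∈ (insert x V).powerset, (if T ⊆ S then e S else 0) ≠ 0).card =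
        (V.powerset.filter fun T => ∑ S ∈ V.powerset, (if T ⊆ S then b S else 0) ≠ 0).card +
        (V.powerset.filter fun T => ∑ S ∈ V.powerset, (if T ⊆ S then a S else 0) ≠ 0).card := by
      rw [Finset.card_filter, Finset.card_filter, Finset.card_filter,
        Finset.sum_powerset_insert hx]
      congr 1
      · refine Finset.sum_congr rfl fun T hT => ?_
        have hxT : x ∉ T := fun h => hx (Finset.mem_powerset.1 hT h)
        have : ∑ S ∈ (insert x V).powerset, (if T ⊆ S then e S else 0) =
            ∑ S ∈ V.powerset, (if T ⊆ S then b S else 0) := by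
          rw [Finset.sum_powerset_insert hx, ← Finset.sum_add_distrib]
          refine Finset.sum_congr rfl fun S _ => ?_
          simp only [Finset.subset_insert_iff_of_notMem hxT]
          split_ifs <;> simp [hb]
        rw [this]
      · refine Finset.sum_congr rfl fun T hT => ?_
        have hxT : x ∉ T := fun h => hx (Finset.mem_powerset.1 hT h)
        have : ∑ S ∈ (insert x V).powerset, (if insert x T ⊆ S then e S else 0) =
            ∑ S ∈ V.powerset, (if T ⊆ S then a S else 0) := by
          rw [Finset.sum_powerset_insert hx, Finset.sum_eq_zero, zero_add]
          · refine Finset.sum_congr rfl fun S _ => ?_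
            simp only [Finset.insert_subset_insert_iff hxT, ha]
          · intro S hS
            rw [if_neg]
            exact fun h => hx (Finset.mem_powerset.1 hS (h (Finset.mem_insert_self x T)))
        rw [this]
    rw [hcard]
    have hda : ∀ S ⊆ V, a S ≠ 0 → d - 1 ≤ S.card := by
      intro S hS h
      have h1 := hd (insert x S) (Finset.insert_subset_insert x hS) h
      have h2 := Finset.card_insert_le x S
      omega
    have hdb : ∀ S ⊆ V, b S ≠ 0 → d - 1 ≤ S.card := by
      intro S hS h
      by_cases h0 : a S = 0
      · have h1 := hd S (hS.trans (Finset.subset_insert x V)) (by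
          intro h2; exact h (by simp only [hb]; rw [h2, zero_add]; exact h0))
        omega
      · exact hda S hS h0
    by_cases hA : ∃ S ⊆ V, a S ≠ 0
    · by_cases hB : ∃ S ⊆ V, b S ≠ 0
      · have h1 := ih (d - 1) a hda hA
        have h2 := ih (d - 1) b hdb hB
        have h3 : 2 ^ d ≤ 2 ^ (d - 1) + 2 ^ (d - 1) := by
          rw [← mul_two, ← pow_succ]
          exact Nat.pow_le_pow_right (by norm_num) (by omega)
        omega
      · push Not at hB
        have h1 := ih d a (fun S hS h => hd S (hS.trans (Finset.subset_insert x V)) (by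
          intro h2
          have := hB S hS
          simp only [hb, h2, zero_add] at this
          exact h this)) hA
        omega
    · push Not at hA
      obtain ⟨S, hS, hS0⟩ := hne
      have hxS : x ∉ S := by
        intro h
        refine hS0 ?_
        have := hA (S.erase x) (by
          intro y hy
          have := hS (Finset.mem_of_mem_erase hy)
          exact (Finset.mem_insert.1 this).resolve_left (Finset.ne_of_mem_erase hy))
        simpa only [ha, Finset.insert_erase h] using this
      have hSV : S ⊆ V := (Finset.subset_insert_iff_of_notMem hxS).1 hS
      have h1 := ih d b (fun S hS h => hd S (hS.trans (Finset.subset_insert x V)) (by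
          intro h2
          refine h ?_
          simp only [hb, h2, zero_add]
          exact hA S hS)) ⟨S, hSV, by simp only [hb]; rw [show e (insert x S) = 0 from hA S hSV]; simpa using hS0⟩
      omega

end Count

section Rank

open Polynomial

variable {R : Type*} [CommRing R] [IsDomain R] {n k : ℕ}

open Classical in
/-- A multilinear polynomial over `R[X]` with coefficients `c` whose monomials have at least `d`
variables vanishes if its shift by `-X ^ w` is a combination of fewer than `2 ^ d` polynomials over
`R`, provided that `w` separates the divisors of its monomials. -/
theorem eq_zero_of_shift_rank_lt {d : ℕ} (w : Fin n → ℕ) (κ : Fin k → R[X])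
    (D : Fin k → Finset (Fin n) → R) (c : Finset (Fin n) → R[X])
    (hshift : ∀ S, ∑ T : Finset (Fin n), (if S ⊆ T then c T * ∏ r ∈ T \ S, -(X : R[X]) ^ w r else 0) =
      ∑ i, κ i * C (D i S))
    (hd : ∀ T, c T ≠ 0 → d ≤ T.card) (hk : k < 2 ^ d)
    (hsep : ∀ T T', c T ≠ 0 → c T' ≠ 0 → ∀ S ⊆ T, ∀ S' ⊆ T',
      ∑ r ∈ S, w r = ∑ r ∈ S', w r → S = S') (T : Finset (Fin n)) : c T = 0 := by
  by_contra hT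
  -- Scaling every variable by its shift makes the shift one by `1`: the upper sums of `e` are, up
  -- to sign and the factor `X ^ w(S)`, the unshifted coefficients `g S`.
  set e : Finset (Fin n) → R[X] := fun T => c T * ∏ r ∈ T, -(X : R[X]) ^ w r with he
  have hXne : ∀ T : Finset (Fin n), (∏ r ∈ T, -(X : R[X]) ^ w r) ≠ 0 := fun T =>
    Finset.prod_ne_zero_iff.2 fun r _ => neg_ne_zero.2 (pow_ne_zero _ X_ne_zero)
  have hprod : ∀ S : Finset (Fin n), (∏ r ∈ S, -(X : R[X]) ^ w r) =
      C ((-1) ^ S.card) * X ^ (∑ r ∈ S, w r) := by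
    intro S
    rw [← Finset.prod_pow_eq_pow_sum, Finset.prod_neg]
    simp
  obtain ⟨T₀, hT₀, hmax⟩ := Finset.exists_max_image
    (Finset.univ.filter fun T => c T ≠ 0) (fun T => (e T).natDegree) ⟨T, by simp [hT]⟩
  set v := (e T₀).natDegree with hv
  have hle : ∀ T, (e T).natDegree ≤ v := by
    intro T
    by_cases h : c T = 0
    · simp [he, h]
    · exact hmax T (by simp [h])
  set g : Finset (Fin n) → R[X] := fun S => ∑ i, κ i * C (D i S) with hg
  have hE : ∀ S, ∑ T : Finset (Fin n), (if S ⊆ T then e T else 0) =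
      C ((-1) ^ S.card) * X ^ (∑ r ∈ S, w r) * g S := by
    intro S
    rw [hg]
    simp only
    rw [← hshift S, ← hprod, Finset.mul_sum]
    refine Finset.sum_congr rfl fun T _ => ?_
    split_ifs with h
    · rw [he]
      simp only
      rw [← Finset.prod_sdiff h]
      ring
    · rw [mul_zero]
  -- The sets whose upper sum reaches the top degree `v`. For them `g S` has degree exactly `v -
  -- w(S)`, and there are at least `2 ^ d` of them.
  set 𝒯 := Finset.univ.filter fun S : Finset (Fin n) =>
    ∑ T : Finset (Fin n), (if S ⊆ T then (e T).coeff v else 0) ≠ 0 with h𝒯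
  have hcount : 2 ^ d ≤ 𝒯.card := by
    have := two_pow_le_card_upper_sum (Finset.univ : Finset (Fin n)) d (fun T => (e T).coeff v)
      (fun T _ h => hd T (by rintro h0; simp [he, h0] at h))
      ⟨T₀, Finset.subset_univ _, by
        rw [hv]
        exact leadingCoeff_ne_zero.2 (mul_ne_zero (by simpa using hT₀) (hXne _))⟩
    rwa [Finset.powerset_univ] at this
  have hcoeff : ∀ S : Finset (Fin n), ∑ T : Finset (Fin n), (if S ⊆ T then (e T).coeff v else 0) =
      (∑ T : Finset (Fin n), (if S ⊆ T then e T else 0)).coeff v := by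
    intro S
    rw [finsetSum_coeff]
    refine Finset.sum_congr rfl fun T _ => ?_
    split_ifs
    · rfl
    · rw [coeff_zero]
  have hw : ∀ S ∈ 𝒯, ∑ r ∈ S, w r ≤ v ∧ (g S).coeff (v - ∑ r ∈ S, w r) ≠ 0 := by
    intro S hS
    have h1 := (Finset.mem_filter.1 hS).2
    rw [hcoeff, hE, mul_assoc, coeff_C_mul, coeff_X_pow_mul'] at h1
    have h2 := right_ne_zero_of_mul h1
    split_ifs at h2 with h3
    · exact ⟨h3, h2⟩
    · exact absurd rfl h2
  have hhigh : ∀ S : Finset (Fin n), ∀ j, v < j + ∑ r ∈ S, w r → (g S).coeff j = 0 := by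
    intro S j hj
    have h1 : (∑ T : Finset (Fin n), (if S ⊆ T then e T else 0)).coeff (j + ∑ r ∈ S, w r) = 0 := by
      rw [finsetSum_coeff]
      refine Finset.sum_eq_zero fun T _ => ?_
      split_ifs
      · exact coeff_eq_zero_of_natDegree_lt ((hle T).trans_lt hj)
      · simp
    rw [hE, mul_assoc, coeff_C_mul, coeff_X_pow_mul] at h1
    simpa using h1
  have hTsub : ∀ S ∈ 𝒯, ∃ T : Finset (Fin n), c T ≠ 0 ∧ S ⊆ T := by
    intro S hS
    obtain ⟨T, _, h⟩ := Finset.exists_ne_zero_of_sum_ne_zero (Finset.mem_filter.1 hS).2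
    split_ifs at h with h1
    · exact ⟨T, by rintro h0; simp [he, h0] at h, h1⟩
    · exact absurd rfl h
  have hdep : ¬ LinearIndependent R (fun (S : 𝒯) (i : Fin k) => D i S.1) := by
    intro hli
    have := hli.fintype_card_le_finrank
    simp only [Fintype.card_coe, Module.finrank_fintype_fun_eq_card, Fintype.card_fin] at this
    omega
  rw [Fintype.not_linearIndependent_iff] at hdep
  obtain ⟨l, hl, S₁, hS₁⟩ := hdep
  -- The lightest set in the relation has the polynomial `g S₀` of strictly largest degree, so its
  -- leading term cannot cancel.
  obtain ⟨S₀, hS₀, hmin⟩ := Finset.exists_min_image (Finset.univ.filter fun S : 𝒯 => l S ≠ 0)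
    (fun S => ∑ r ∈ S.1, w r) ⟨S₁, by simp [hS₁]⟩
  have hsum : ∑ S : 𝒯, C (l S) * g S.1 = 0 := by
    simp only [hg, Finset.mul_sum]
    rw [Finset.sum_comm]
    refine Finset.sum_eq_zero fun i _ => ?_
    have := congrFun hl i
    simp only [Finset.sum_apply, Pi.smul_apply, smul_eq_mul, Pi.zero_apply] at this
    calc ∑ S : 𝒯, C (l S) * (κ i * C (D i S.1)) = κ i * C (∑ S : 𝒯, l S * D i S.1) := by
          rw [map_sum, Finset.mul_sum]
          refine Finset.sum_congr rfl fun S _ => ?_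
          rw [C_mul]; ring
      _ = 0 := by rw [this]; simp
  have hc := congrArg (fun p => p.coeff (v - ∑ r ∈ S₀.1, w r)) hsum
  simp only [finsetSum_coeff, coeff_C_mul, coeff_zero] at hc
  rw [Finset.sum_eq_single S₀] at hc
  · exact mul_ne_zero (Finset.mem_filter.1 hS₀).2 (hw S₀ S₀.2).2 hc
  · intro S _ hne
    by_cases h0 : l S = 0
    · rw [h0, zero_mul]
    · have h1 := hmin S (by simp [h0])
      have h2 : ∑ r ∈ S.1, w r ≠ ∑ r ∈ S₀.1, w r := by
        intro h
        obtain ⟨T, hT, hST⟩ := hTsub S.1 S.2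
        obtain ⟨T', hT', hST'⟩ := hTsub S₀.1 S₀.2
        exact hne (Subtype.ext (hsep T T' hT hT' S.1 hST S₀.1 hST' h))
      have h3 := (hw S₀ S₀.2).1
      rw [hhigh S.1 _ (by omega), mul_zero]
  · simp

end Rank

end AffineProduct

/-! ### Concentration for one base set -/

section Partition

variable {n k : ℕ}

/-- The finest partition that is coarser than the partitions `P i` with `i < q`. -/
def joinSetoid (P : Fin k → Finpartition (Finset.univ : Finset (Fin n))) (q : ℕ) : Setoid (Fin n) :=
  Relation.EqvGen.setoid fun a b => ∃ i : Fin k, (i : ℕ) < q ∧ (P i).part a = (P i).part b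

theorem joinSetoid_mono (P : Fin k → Finpartition (Finset.univ : Finset (Fin n))) {q q' : ℕ}
    (h : q ≤ q') {a b : Fin n} (hab : joinSetoid P q a b) : joinSetoid P q' a b :=
  Relation.EqvGen.mono (fun _ _ ⟨i, hi, e⟩ => ⟨i, hi.trans_le h, e⟩) _ _ hab

/-- Saturation passes from the single partitions to their join because membership in `U` is itself
an equivalence relation that contains them. -/
theorem mem_iff_of_joinSetoid {P : Fin k → Finpartition (Finset.univ : Finset (Fin n))} {q : ℕ}
    {U : Set (Fin n)}
    (hU : ∀ i : Fin k, (i : ℕ) < q → ∀ a b, (P i).part a = (P i).part b → a ∈ U → b ∈ U)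
    {a b : Fin n} (hab : joinSetoid P q a b) : a ∈ U ↔ b ∈ U := by
  induction hab with
  | rel a b h =>
    obtain ⟨i, hi, e⟩ := h
    exact ⟨hU i hi a b e, hU i hi b a e.symm⟩
  | refl => exact Iff.rfl
  | symm _ _ _ ih => exact ih.symm
  | trans _ _ _ _ _ ih1 ih2 => exact ih1.trans ih2

/-- A block of the join of `P 0, …, P i` contains at most `δ` colors of `P i`. -/
theorem exists_part_eq_of_card_lt {P : Fin k → Finpartition (Finset.univ : Finset (Fin n))} {δ : ℕ}
    (hP : PartitionDistLE P δ) (hδ : 1 ≤ δ) (i : Fin k) {R : Finset (Fin n)}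
    (hR : ∀ a ∈ R, ∀ b ∈ R, joinSetoid P (i + 1) a b) (hcard : δ < R.card) :
    ∃ a ∈ R, ∃ b ∈ R, a ≠ b ∧ (P i).part a = (P i).part b := by
  obtain ⟨r₀, hr₀⟩ : R.Nonempty := Finset.card_pos.1 (by omega)
  -- For `i = 0` the color of `r₀` alone serves, which is where `1 ≤ δ` enters. The union of `N` is
  -- saturated for `P 0, …, P i`, so it contains all of `R`, and more than `δ` variables fall into
  -- at most `δ` colors.
  obtain ⟨N, hN, hYN, hNδ, hNj⟩ : ∃ N ⊆ (P i).parts, (P i).part r₀ ∈ N ∧ N.card ≤ δ ∧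
      ∀ j < i, ∃ Z ⊆ (P j).parts, Z.sup id = N.sup id := by
    by_cases hi : 0 < (i : ℕ)
    · exact hP i hi _ ((P i).part_mem.2 (Finset.mem_univ _))
    · refine ⟨{(P i).part r₀}, by simp, by simp, by simpa using hδ, fun j hj => ?_⟩
      exact absurd (Fin.lt_def.1 hj) (by omega)
  have hsat : ∀ (j : Fin k) (Z : Finset (Finset (Fin n))), Z ⊆ (P j).parts → ∀ a b,
      (P j).part a = (P j).part b → a ∈ Z.sup id → b ∈ Z.sup id := by
    intro j Z hZ a b hab ha
    rw [Finset.mem_sup] at ha ⊢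
    obtain ⟨Y, hY, haY⟩ := ha
    refine ⟨Y, hY, ?_⟩
    have h1 : (P j).part a = Y := (P j).part_eq_of_mem (hZ hY) haY
    have h2 : b ∈ (P j).part b := (P j).mem_part (Finset.mem_univ b)
    rw [← hab, h1] at h2
    exact h2
  have hU : ∀ j : Fin k, (j : ℕ) < i + 1 → ∀ a b, (P j).part a = (P j).part b →
      a ∈ (↑(N.sup id) : Set (Fin n)) → b ∈ (↑(N.sup id) : Set (Fin n)) := by
    intro j hj a b hab ha
    rw [Finset.mem_coe] at ha ⊢
    rcases (Nat.lt_succ_iff.1 hj).lt_or_eq with h | h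
    · obtain ⟨Z, hZ, hZN⟩ := hNj j (Fin.lt_def.2 h)
      rw [← hZN] at ha ⊢
      exact hsat j Z hZ a b hab ha
    · obtain rfl : j = i := Fin.ext h
      exact hsat j N hN a b hab ha
  have hr₀N : r₀ ∈ N.sup id :=
    Finset.mem_sup.2 ⟨_, hYN, (P i).mem_part (Finset.mem_univ r₀)⟩
  have hmaps : ∀ r ∈ R, (P i).part r ∈ N := by
    intro r hr
    have : r ∈ N.sup id := (mem_iff_of_joinSetoid hU (hR r₀ hr₀ r hr)).1 hr₀N
    obtain ⟨Y, hY, hrY⟩ := Finset.mem_sup.1 this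
    rwa [(P i).part_eq_of_mem (hN hY) hrY]
  obtain ⟨a, ha, b, hb, hne, e⟩ :=
    Finset.exists_ne_map_eq_of_card_lt_of_maps_to (hNδ.trans_lt hcard) hmaps
  exact ⟨a, ha, b, hb, hne, e⟩

end Partition

/-! ### Effect of a shift on the coefficients of a multilinear polynomial. -/

namespace AffineProduct

section Shift

open MvPolynomial

variable {A : Type*} [CommRing A] {n : ℕ}

theorem aeval_affine (b : Fin n → A) (u : A) (β : Fin n → A) :
    aeval (fun r => X r + C (b r)) (affine u β) = affine (u + ∑ r, β r * b r) β := by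
  simp only [affine, map_add, map_sum, map_mul, aeval_X, algHom_C, algebraMap_eq, mul_add,
    Finset.sum_add_distrib, add_assoc]
  ring

theorem setCoeff_prod_X_add_C (S T : Finset (Fin n)) (b : Fin n → A) :
    setCoeff S (∏ r ∈ T, (X r + C (b r))) = if S ⊆ T then ∏ r ∈ T \ S, b r else 0 := by
  have hX : ∀ T : Finset (Fin n), (∏ r ∈ T, X r : MvPolynomial (Fin n) A) =
      monomial (∑ r ∈ T, Finsupp.single r 1) 1 := fun T => by
    rw [monomial_sum_one]; rfl
  rw [Finset.prod_add, setCoeff_sum]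
  have : ∀ S' ∈ T.powerset, setCoeff S ((∏ r ∈ S', X r) * ∏ r ∈ T \ S', C (b r)) =
      if S' = S then ∏ r ∈ T \ S, b r else 0 := by
    intro S' _
    rw [mul_comm, ← map_prod, setCoeff_C_mul, hX, setCoeff, coeff_monomial]
    by_cases h : S' = S
    · rw [if_pos h, if_pos (by rw [h]), h, mul_one]
    · rw [if_neg h, if_neg fun e => h (sum_single_injective e), mul_zero]
  rw [Finset.sum_congr rfl this, Finset.sum_ite_eq']
  simp

theorem setCoeff_aeval_X_add_C {p : MvPolynomial (Fin n) A} (hp : Multilin p) (b : Fin n → A)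
    (S : Finset (Fin n)) :
    setCoeff S (aeval (fun r => X r + C (b r)) p) =
      ∑ T, (if S ⊆ T then setCoeff T p * ∏ r ∈ T \ S, b r else 0) := by
  conv_lhs => rw [hp.eq_sum]
  simp only [map_sum, map_mul, map_prod, aeval_X, algHom_C, algebraMap_eq]
  rw [setCoeff_sum]
  refine Finset.sum_congr rfl fun T _ => ?_
  rw [setCoeff_C_mul, setCoeff_prod_X_add_C, mul_ite, mul_zero]

end Shift

end AffineProduct

/-! ### Shifted products over one base set. -/

namespace AffineProduct

section OneBaseSet

open Polynomial

variable {R : Type*} [CommRing R] {n k : ℕ}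

/-- The product of the affine forms `c j + ∑ r, β j r * (x r + X ^ w r)`. -/
noncomputable def shiftedProd {ι : Type*} (w : Fin n → ℕ) (J : Finset ι) (c : ι → R)
    (β : ι → Fin n → R) : MvPolynomial (Fin n) R[X] :=
  ∏ j ∈ J, affine (C (c j) + ∑ r, C (β j r) * X ^ w r) (fun r => C (β j r))

/-- Undoing the shift makes all coefficients free of `X`, as the rank argument requires. -/
theorem aeval_shiftedProd {ι : Type*} (w : Fin n → ℕ) (J : Finset ι) (c : ι → R)
    (β : ι → Fin n → R) :
    MvPolynomial.aeval (fun r => MvPolynomial.X r + MvPolynomial.C (-(X : R[X]) ^ w r))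
      (shiftedProd w J c β) = MvPolynomial.map C (∏ j ∈ J, affine (c j) (β j)) := by
  rw [shiftedProd, map_prod, map_prod]
  refine Finset.prod_congr rfl fun j _ => ?_
  rw [aeval_affine, map_affine]
  congr 1
  simp

theorem ReadOnce.map_C {ι : Type*} {J : Finset ι} {β : ι → Fin n → R} (h : ReadOnce J β) :
    ReadOnce J (fun j r => (C (β j r) : R[X])) := by
  intro j hj j' hj' r h1 h2
  exact h j hj j' hj' r (by simpa using h1) (by simpa using h2)

variable [IsDomain R]

open Classical in
/-- A combination over `R[X]` of fewer than `2 ^ l` shifted products of affine forms that share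
no variables vanishes if its monomials have at least `l` and at most `s` variables and `w`
separates the sets of at most `s` variables. -/
theorem eq_zero_of_card_mem_Icc {l s : ℕ} {ι : Fin k → Type*} (J : ∀ i, Finset (ι i))
    (c : ∀ i, ι i → R) (β : ∀ i, ι i → Fin n → R) (hread : ∀ i, ReadOnce (J i) (β i))
    {w : Fin n → ℕ} {B : Set (Fin n)} (hB : ∀ i, ∀ j ∈ J i, ∀ r, β i j r ≠ 0 → r ∈ B)
    (hw : ∀ S T : Finset (Fin n), (∀ r ∈ S, r ∈ B) → (∀ r ∈ T, r ∈ B) → S.card ≤ s → T.card ≤ s →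
      ∑ r ∈ S, w r = ∑ r ∈ T, w r → S = T)
    (hk : k < 2 ^ l) (κ : Fin k → R[X])
    (h : ∀ S, ∑ i, κ i * setCoeff S (shiftedProd w (J i) (c i) (β i)) ≠ 0 →
      l ≤ S.card ∧ S.card ≤ s) (S : Finset (Fin n)) :
    ∑ i, κ i * setCoeff S (shiftedProd w (J i) (c i) (β i)) = 0 := by
  have hml : ∀ i, Multilin (shiftedProd w (J i) (c i) (β i)) := fun i =>
    multilin_prod (hread i).map_C
  have hsub : ∀ T : Finset (Fin n),
      ∑ i, κ i * setCoeff T (shiftedProd w (J i) (c i) (β i)) ≠ 0 → ∀ r ∈ T, r ∈ B := by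
    intro T hT r hr
    by_contra hrB
    refine hT (Finset.sum_eq_zero fun i _ => ?_)
    rw [shiftedProd, setCoeff_prod_of_absent hr, mul_zero]
    intro j hj
    rw [C_eq_zero]
    by_contra hne
    exact hrB (hB i j hj r hne)
  refine eq_zero_of_shift_rank_lt w κ (fun i S => setCoeff S (∏ j ∈ J i, affine (c i j) (β i j)))
    (fun S => ∑ i, κ i * setCoeff S (shiftedProd w (J i) (c i) (β i))) ?_
    (fun T hT => (h T hT).1) hk ?_ S
  · intro S
    have hP : Multilin (∑ i, MvPolynomial.C (κ i) * shiftedProd w (J i) (c i) (β i)) :=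
      Multilin.sum fun i _ => (hml i).C_mul _
    have h1 := setCoeff_aeval_X_add_C hP (fun r => -(X : R[X]) ^ w r) S
    simp only [setCoeff_sum, setCoeff_C_mul] at h1
    rw [← h1, map_sum, setCoeff_sum]
    refine Finset.sum_congr rfl fun i _ => ?_
    rw [map_mul, aeval_shiftedProd, MvPolynomial.algHom_C, MvPolynomial.algebraMap_eq,
      setCoeff_C_mul, setCoeff_map]
  · intro T T' hT hT' S hS S' hS' e
    exact hw S S' (fun r hr => hsub T hT r (hS hr)) (fun r hr => hsub T' hT' r (hS' hr))
      ((Finset.card_le_card hS).trans (h T hT).2) ((Finset.card_le_card hS').trans (h T' hT').2) e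

open Classical in
/-- If a combination over `R[X]` of fewer than `2 ^ l` shifted products of affine forms, which
induce a partition sequence of distance at most `δ`, has no monomials in at most `l + δ`
variables, then it is zero. -/
theorem eq_zero_of_forall_card_le {l δ : ℕ}
    {P : Fin k → Finpartition (Finset.univ : Finset (Fin n))} (hP : PartitionDistLE P δ)
    (hδ : 1 ≤ δ) {ι : Fin k → Type*} (J : ∀ i, Finset (ι i))
    (c : ∀ i, ι i → R) (β : ∀ i, ι i → Fin n → R)
    (hind : ∀ i, ∀ j ∈ J i, ∀ j' ∈ J i, ∀ r r', β i j r ≠ 0 → β i j' r' ≠ 0 →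
      ((P i).part r = (P i).part r' ↔ j = j'))
    {w : Fin n → ℕ} {B : Set (Fin n)} (hB : ∀ i, ∀ j ∈ J i, ∀ r, β i j r ≠ 0 → r ∈ B)
    (hw : ∀ S T : Finset (Fin n), (∀ r ∈ S, r ∈ B) → (∀ r ∈ T, r ∈ B) → S.card ≤ δ * l →
      T.card ≤ δ * l → ∑ r ∈ S, w r = ∑ r ∈ T, w r → S = T)
    (hk : k < 2 ^ l) (κ : Fin k → R[X])
    (h : ∀ S : Finset (Fin n), S.card ≤ l + δ →
      ∑ i, κ i * setCoeff S (shiftedProd w (J i) (c i) (β i)) = 0) (S : Finset (Fin n)) :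
    ∑ i, κ i * setCoeff S (shiftedProd w (J i) (c i) (β i)) = 0 := by
  have hread : ∀ i, ReadOnce (J i) (β i) := fun i j hj j' hj' r h1 h2 =>
    (hind i j hj j' hj' r r h1 h2).1 rfl
  set F : Finset (Fin n) → R[X] := fun S =>
    ∑ i, κ i * setCoeff S (shiftedProd w (J i) (c i) (β i)) with hF
  by_contra hS
  change F S ≠ 0 at hS
  -- Two variables of the same color can only come from the same factor, which contributes at most
  -- one of them.
  have hkill : ∀ i, ∀ T : Finset (Fin n), (∃ a ∈ T, ∃ b ∈ T, a ≠ b ∧ (P i).part a = (P i).part b) →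
      setCoeff T (shiftedProd w (J i) (c i) (β i)) = 0 := by
    rintro i T ⟨a, ha, b, hb, hne, e⟩
    by_cases hpa : ∃ j ∈ J i, β i j a ≠ 0
    · obtain ⟨j₀, hj₀, hja⟩ := hpa
      refine setCoeff_prod_of_two (hread i).map_C ha hb hne fun j hj hjb => ?_
      have := (hind i j₀ hj₀ j hj a b hja (by simpa using hjb)).1 e
      simpa [← this] using hja
    · push Not at hpa
      exact setCoeff_prod_of_absent ha fun j hj => by rw [hpa j hj, C_0]
  -- No monomial that occurs has more than `δ` variables in one block of the join of `P 0, …, P (q -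
  -- 1)`.
  let thin : ℕ → Prop := fun q => ∀ S, F S ≠ 0 → ∀ R ⊆ S,
    (∀ a ∈ R, ∀ b ∈ R, joinSetoid P q a b) → R.card ≤ δ
  -- Here `q` is the last index before thinness first fails, and `Z` consists of `δ + 1` variables
  -- of a monomial in one block of the next join. Every gate `i ≥ q` has two of them in one color
  -- and is killed on multiples of `Z`. If thinness never fails, `q = k` and `Z = ∅`.
  obtain ⟨q, Z, hthin, hZ, ⟨S₁, hS₁, hZS₁⟩, hZkill⟩ : ∃ (q : ℕ) (Z : Finset (Fin n)), thin q ∧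
      Z.card ≤ δ + 1 ∧ (∃ S, F S ≠ 0 ∧ Z ⊆ S) ∧ ∀ i : Fin k, q ≤ (i : ℕ) → ∀ T, Z ⊆ T →
        setCoeff T (shiftedProd w (J i) (c i) (β i)) = 0 := by
    by_cases hall : thin k
    · exact ⟨k, ∅, hall, by simp, ⟨S, hS, by simp⟩, fun i hi => absurd i.2 (by omega)⟩
    · have hex : ∃ q, ¬ thin q := ⟨k, hall⟩
      have hqk : Nat.find hex ≤ k := Nat.find_min' hex hall
      have hq0 : Nat.find hex ≠ 0 := by
        intro h0
        have hsp := Nat.find_spec hex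
        rw [h0] at hsp
        -- The join of no partitions is equality, so its blocks are singletons.
        refine hsp fun S _ Z _ hZ => ?_
        refine (Finset.card_le_one.2 fun a ha b hb => ?_).trans hδ
        have := (mem_iff_of_joinSetoid (U := {a}) (fun i hi => absurd hi (by omega))
          (hZ a ha b hb)).1 rfl
        exact this.symm
      obtain ⟨q, hq⟩ := Nat.exists_eq_succ_of_ne_zero hq0
      have hthin : thin q := not_not.1 (Nat.find_min hex (by omega))
      have hsp := Nat.find_spec hex
      rw [hq] at hsp
      simp only [thin] at hsp
      push Not at hsp
      obtain ⟨S₁, hS₁, R', hR'S, hR', hcard⟩ := hsp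
      obtain ⟨Z, hZR, hZc⟩ := Finset.exists_subset_card_eq (Nat.succ_le_of_lt hcard)
      refine ⟨q, Z, hthin, hZc.le, ⟨S₁, hS₁, hZR.trans hR'S⟩, fun i hi T hT => hkill i T ?_⟩
      obtain ⟨a, ha, b, hb, hne, e⟩ := exists_part_eq_of_card_lt hP hδ i (R := Z)
        (fun a ha b hb => joinSetoid_mono P (by omega) (hR' a (hZR ha) b (hZR hb))) (by omega)
      exact ⟨a, hT ha, b, hT hb, hne, e⟩
  let blk : Fin n → Quotient (joinSetoid P q) := fun r => Quotient.mk _ r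
  have hblk : ∀ a b, blk a = blk b ↔ joinSetoid P q a b := fun a b => Quotient.eq
  -- Among the monomials divisible by `Z`, one that meets the fewest blocks outside `Z`; the
  -- minimality yields the lower bound `l ≤ T.card` below.
  obtain ⟨S, hSmem, hmin⟩ := Finset.exists_min_image
    (Finset.univ.filter fun S : Finset (Fin n) => F S ≠ 0 ∧ Z ⊆ S)
    (fun S => ((S \ Z).image blk).card) ⟨S₁, by simp [hS₁, hZS₁]⟩
  obtain ⟨hSF, hZS⟩ := (Finset.mem_filter.1 hSmem).2
  obtain ⟨𝓑, h𝓑, h𝓑c⟩ := Finset.exists_subset_card_eq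
    (min_le_left ((S \ Z).image blk).card l)
  -- Only the variables in the at most `l` chosen blocks stay free. `Zp` consists of the frozen
  -- variables, and `U` is saturated for all gates before `q`.
  set U : Finset (Fin n) := Finset.univ.filter fun r => blk r ∈ 𝓑 with hU
  set Zp : Finset (Fin n) := Z ∪ S \ U with hZp
  have hsat : ∀ i : Fin k, (i : ℕ) < q → ∀ a b, (P i).part a = (P i).part b → a ∈ U → b ∈ U := by
    intro i hi a b hab ha
    have : blk a = blk b := (hblk a b).2 (Relation.EqvGen.rel _ _ ⟨i, hi, hab⟩)
    simpa [hU, ← this] using ha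
  choose ε hε using fun i => exists_setCoeff_union_prod
    (u := fun j => C (c i j) + ∑ r, C (β i j r) * X ^ w r) (hread i).map_C Zp
  set J₁ : ∀ i, Finset (ι i) := fun i =>
    (J i).filter fun j => ∀ r ∈ Zp, (C (β i j r) : R[X]) = 0 with hJ₁
  set J₂ : ∀ i, Finset (ι i) := fun i =>
    (J₁ i).filter fun j => ∃ r ∈ (U : Set (Fin n)), (C (β i j r) : R[X]) ≠ 0 with hJ₂
  -- The frozen variables and the factors without variables in `U` become part of the coefficient of
  -- the gate. The remaining factors have all their variables in `U`, outside `Zp`.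
  set κ' : Fin k → R[X] := fun i => if (i : ℕ) < q then κ i * ε i *
    ∏ j ∈ (J₁ i).filter (fun j => ¬ ∃ r ∈ (U : Set (Fin n)), (C (β i j r) : R[X]) ≠ 0),
      (C (c i j) + ∑ r, C (β i j r) * X ^ w r) else 0 with hκ'
  have hJ : ∀ i, J₂ i ⊆ J i := fun i => (Finset.filter_subset _ _).trans (Finset.filter_subset _ _)
  have hcoef : ∀ T ⊆ U, Disjoint Zp T →
      ∑ i, κ' i * setCoeff T (shiftedProd w (J₂ i) (c i) (β i)) = F (Zp ∪ T) := by
    intro T hTU hdis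
    rw [hF]
    refine Finset.sum_congr rfl fun i _ => ?_
    by_cases hi : (i : ℕ) < q
    · have h1 : setCoeff (Zp ∪ T) (shiftedProd w (J i) (c i) (β i)) = ε i * setCoeff T
          (∏ j ∈ J₁ i, affine (C (c i j) + ∑ r, C (β i j r) * X ^ w r) fun r => C (β i j r)) := by
        rw [shiftedProd, hε i T hdis]
        congr!
      have h2 : setCoeff T (∏ j ∈ J₁ i,
            affine (C (c i j) + ∑ r, C (β i j r) * X ^ w r) fun r => C (β i j r)) =
          (∏ j ∈ (J₁ i).filter (fun j => ¬ ∃ r ∈ (U : Set (Fin n)), (C (β i j r) : R[X]) ≠ 0),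
            (C (c i j) + ∑ r, C (β i j r) * X ^ w r)) *
          setCoeff T (shiftedProd w (J₂ i) (c i) (β i)) :=
        setCoeff_prod_filter (J₁ i) (U : Set (Fin n)) _ (by exact_mod_cast hTU)
      simp only [hκ', if_pos hi]
      rw [h1, h2]
      ring
    · simp only [hκ', if_neg hi, zero_mul]
      rw [hZkill i (by omega) _ (by
        rw [hZp, Finset.union_assoc]; exact Finset.subset_union_left), mul_zero]
  have hsupp : ∀ T, ∑ i, κ' i * setCoeff T (shiftedProd w (J₂ i) (c i) (β i)) ≠ 0 →
      T ⊆ U ∧ Disjoint Zp T := by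
    intro T hT
    have key : ∀ r ∈ T, r ∈ U ∧ r ∉ Zp := by
      intro r hr
      by_contra hcon
      refine hT (Finset.sum_eq_zero fun i _ => ?_)
      by_cases hi : (i : ℕ) < q
      · rw [shiftedProd, setCoeff_prod_of_absent hr, mul_zero]
        intro j hj
        by_contra hne
        obtain ⟨hj1, r', hr'U, hr'⟩ := Finset.mem_filter.1 hj
        obtain ⟨hj0, hj1⟩ := Finset.mem_filter.1 hj1
        refine hcon ⟨?_, fun hrZ => hne (hj1 r hrZ)⟩
        refine hsat i hi r' r ?_ (by simpa using hr'U)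
        exact (hind i j hj0 j hj0 r' r (by simpa using hr') (by simpa using hne)).2 rfl
      · simp only [hκ', if_neg hi, zero_mul]
    exact ⟨fun r hr => (key r hr).1, Finset.disjoint_right.2 fun r hr => (key r hr).2⟩
  -- Lower bound: with `l` chosen blocks, a `T` that met fewer of them would contradict the
  -- minimality of `S`. With fewer than `l` blocks in all, `Zp = Z` has at most `δ + 1` variables,
  -- while `Zp ∪ T` must have more than `l + δ`. Upper bound: at most `l` blocks with at most `δ`
  -- variables each, by thinness.
  have hbd : ∀ T, ∑ i, κ' i * setCoeff T (shiftedProd w (J₂ i) (c i) (β i)) ≠ 0 →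
      l ≤ T.card ∧ T.card ≤ δ * l := by
    intro T hT
    obtain ⟨hTU, hdis⟩ := hsupp T hT
    have hFT : F (Zp ∪ T) ≠ 0 := by rwa [← hcoef T hTU hdis]
    constructor
    · rcases le_or_gt l ((S \ Z).image blk).card with hl | hl
      · rw [min_eq_right hl] at h𝓑c
        have h1 := hmin (Zp ∪ T) (by
          simp only [Finset.mem_filter, Finset.mem_univ, true_and]
          exact ⟨hFT, by rw [hZp, Finset.union_assoc]; exact Finset.subset_union_left⟩)
        have h2 : ((Zp ∪ T) \ Z).image blk ⊆ T.image blk ∪ ((S \ Z).image blk) \ 𝓑 := by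
          intro y hy
          obtain ⟨r, hr, rfl⟩ := Finset.mem_image.1 hy
          simp only [hZp, Finset.mem_sdiff, Finset.mem_union] at hr
          rcases hr with ⟨(hr | ⟨hrS, hrU⟩) | hr, hrZ⟩
          · exact absurd hr hrZ
          · refine Finset.mem_union_right _ (Finset.mem_sdiff.2 ⟨Finset.mem_image_of_mem _
              (Finset.mem_sdiff.2 ⟨hrS, hrZ⟩), fun hb => hrU ?_⟩)
            simpa [hU] using hb
          · exact Finset.mem_union_left _ (Finset.mem_image_of_mem _ hr)
        have h3 := (Finset.card_le_card h2).trans (Finset.card_union_le _ _)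
        rw [Finset.card_sdiff_of_subset h𝓑] at h3
        have h4 : (T.image blk).card ≤ T.card := Finset.card_image_le
        omega
      · rw [min_eq_left hl.le] at h𝓑c
        have h𝓑e : 𝓑 = (S \ Z).image blk := Finset.eq_of_subset_of_card_le h𝓑 h𝓑c.ge
        have hZpZ : Zp ⊆ Z := by
          rw [hZp]
          refine Finset.union_subset le_rfl fun r hr => ?_
          by_contra hrZ
          refine (Finset.mem_sdiff.1 hr).2 ?_
          simp only [hU, Finset.mem_filter, Finset.mem_univ, true_and, h𝓑e]
          exact Finset.mem_image_of_mem _ (Finset.mem_sdiff.2 ⟨(Finset.mem_sdiff.1 hr).1, hrZ⟩)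
        have h1 : l + δ < (Zp ∪ T).card := by
          by_contra hle
          exact hFT (h _ (not_lt.1 hle))
        have h2 := Finset.card_union_le Zp T
        have h3 := Finset.card_le_card hZpZ
        omega
    · have h1 : T.card = ∑ b ∈ 𝓑, (T.filter fun r => blk r = b).card :=
        Finset.card_eq_sum_card_fiberwise fun r hr => by
          have := hTU hr
          simpa [hU] using this
      rw [h1]
      calc ∑ b ∈ 𝓑, (T.filter fun r => blk r = b).card ≤ 𝓑.card * δ := by
            refine Finset.sum_le_card_nsmul _ _ _ fun b _ => ?_
            refine hthin _ hFT _ ((Finset.filter_subset _ T).trans Finset.subset_union_right) ?_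
            intro a ha a' ha'
            exact (hblk a a').1 ((Finset.mem_filter.1 ha).2.trans (Finset.mem_filter.1 ha').2.symm)
        _ ≤ δ * l := by
            rw [mul_comm]
            exact Nat.mul_le_mul_left _ (h𝓑c.le.trans (min_le_right _ _))
  have hfin := eq_zero_of_card_mem_Icc J₂ c β (fun i => (hread i).mono (hJ i))
    (fun i j hj => hB i j (hJ i hj)) hw hk κ' hbd (S \ Zp)
  have hSU : S \ Zp ⊆ U := by
    intro r hr
    by_contra hrU
    exact (Finset.mem_sdiff.1 hr).2 (Finset.mem_union_right _
      (Finset.mem_sdiff.2 ⟨(Finset.mem_sdiff.1 hr).1, hrU⟩))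
  rw [hcoef _ hSU Finset.disjoint_sdiff, Finset.union_sdiff_of_subset] at hfin
  · exact hSF hfin
  · exact Finset.union_subset hZS Finset.sdiff_subset

end OneBaseSet

end AffineProduct

/-! ### Concentration of the shifted vector of product gates -/

namespace AffineProduct

/-- Allows the variables outside one base set to be deleted from the forms while their shifts stay
in the constants. -/
theorem setCoeff_prod_congr {A : Type*} [CommRing A] {n : ℕ} {ι : Type*} {J : Finset ι}
    {u : ι → A} {β β' : ι → Fin n → A} {T : Finset (Fin n)}
    (h : ∀ j ∈ J, ∀ r ∈ T, β j r = β' j r) :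
    setCoeff T (∏ j ∈ J, affine (u j) (β j)) = setCoeff T (∏ j ∈ J, affine (u j) (β' j)) := by
  classical
  induction J using Finset.induction_on generalizing T with
  | empty => simp
  | insert a J ha ih =>
    rw [Finset.prod_insert ha, Finset.prod_insert ha, setCoeff_affine_mul, setCoeff_affine_mul,
      ih fun j hj => h j (by simp [hj])]
    congr 1
    refine Finset.sum_congr rfl fun r hr => ?_
    rw [h a (by simp) r hr, ih fun j hj r' hr' => h j (by simp [hj]) r' (Finset.mem_of_mem_erase hr')]

end AffineProduct

namespace Depth3Circuit

open AffineProduct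

variable {F : Type*} [Field F] {n k m : ℕ}

/-- The constant of the `j`-th factor of the `i`-th gate after the shift. -/
noncomputable def shiftedConst (Q : Depth3Circuit F n k) (base : Fin n → Fin m) (w : Fin n → ℕ)
    (i : Fin k) (j : Fin (Q.fanin i)) : MvPolynomial (Fin m) F :=
  MvPolynomial.C (Q.lin i j).const +
    ∑ r, MvPolynomial.C ((Q.lin i j).coef r) * MvPolynomial.X (base r) ^ w r

/-- The shifted gates over the ring of polynomials in the shift variables. -/
noncomputable def polyGate (Q : Depth3Circuit F n k) (base : Fin n → Fin m) (w : Fin n → ℕ)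
    (i : Fin k) : MvPolynomial (Fin n) (MvPolynomial (Fin m) F) :=
  ∏ j, affine (Q.shiftedConst base w i j) fun r => MvPolynomial.C ((Q.lin i j).coef r)

/-- The gates live over the polynomial ring in the shift variables, where degrees in these variables
make sense. -/
theorem shiftedGate_eq_map (Q : Depth3Circuit F n k) (base : Fin n → Fin m) (w : Fin n → ℕ)
    (i : Fin k) : Q.shiftedGate base w i =
      MvPolynomial.map (algebraMap (MvPolynomial (Fin m) F) (ShiftField F m))
        (Q.polyGate base w i) := by
  have hC : ∀ a : F, algebraMap F (MvPolynomial (Fin n) (ShiftField F m)) a =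
      MvPolynomial.C (algebraMap (MvPolynomial (Fin m) F) (ShiftField F m) (MvPolynomial.C a)) := by
    intro a
    rw [IsScalarTower.algebraMap_apply F (ShiftField F m), MvPolynomial.algebraMap_eq,
      IsScalarTower.algebraMap_apply F (MvPolynomial (Fin m) F) (ShiftField F m),
      MvPolynomial.algebraMap_eq]
  rw [shiftedGate, polyGate, gate, map_prod, map_prod]
  refine Finset.prod_congr rfl fun j _ => ?_
  rw [LinForm.poly, map_affine, affine, shiftedConst]
  simp only [map_add, map_sum, map_mul, MvPolynomial.aeval_X, MvPolynomial.algHom_C, hC, mul_add,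
    Finset.sum_add_distrib, map_pow]
  ring

/-- Both occurrences of `r` survive the restriction to its own base set, and a variable has the same
color as itself. -/
theorem readOnce_of_hasBaseSetsDistance {Q : Depth3Circuit F n k} {base : Fin n → Fin m} {δ : ℕ}
    (hQ : Q.HasBaseSetsDistance base δ) (i : Fin k) (j j' : Fin (Q.fanin i)) (r : Fin n)
    (h : (Q.lin i j).coef r ≠ 0) (h' : (Q.lin i j').coef r ≠ 0) : j = j' := by
  obtain ⟨e, P, hP, -⟩ := hQ (base r)
  obtain ⟨i, rfl⟩ := e.surjective i
  refine ((hP i) j j' r r ?_ ?_).1 rfl <;>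
    simpa [restrict, LinForm.Present, LinForm.restrict] using ‹_›

open Classical in
/-- Substitution of a polynomial variable for one of the shift variables. -/
noncomputable def singleOut (b : Fin m) :
    MvPolynomial (Fin m) F →+* Polynomial (MvPolynomial (Fin m) F) :=
  MvPolynomial.eval₂Hom (Polynomial.C.comp MvPolynomial.C)
    fun b' => if b' = b then Polynomial.X else Polynomial.C (MvPolynomial.X b')

/-- Evaluation of the polynomial variable at `X b` is a left inverse. -/
theorem singleOut_injective (b : Fin m) : Function.Injective (singleOut (F := F) b) := by
  have : (Polynomial.evalRingHom (MvPolynomial.X b)).comp (singleOut (F := F) b) =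
      RingHom.id _ := by
    refine MvPolynomial.ringHom_ext (fun a => by simp [singleOut]) fun b' => ?_
    by_cases h : b' = b <;> simp [singleOut, h]
  exact Function.LeftInverse.injective (g := Polynomial.evalRingHom (MvPolynomial.X b))
    fun x => DFunLike.congr_fun this x

open Classical in
theorem eq_zero_of_forall_base_card_le {δ : ℕ} {Q : Depth3Circuit F n k} {base : Fin n → Fin m}
    {w : Fin n → ℕ} (hδ : 1 ≤ δ) (hQ : Q.HasBaseSetsDistance base δ)
    (hw : SeparatesBaseSets base w (δ * Nat.clog 2 (k + 1)))
    (a : Fin k → MvPolynomial (Fin m) F)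
    (h : ∀ S : Finset (Fin n),
      (∀ b, (S.filter fun r => base r = b).card ≤ Nat.clog 2 (k + 1) + δ) →
      ∑ i, a i * setCoeff S (Q.polyGate base w i) = 0)
    (S : Finset (Fin n)) : ∑ i, a i * setCoeff S (Q.polyGate base w i) = 0 := by
  -- `𝓢` collects the base sets on which the size of the monomial is no longer bounded; it grows
  -- from `∅` to everything, one base set at a time.
  have key : ∀ 𝓢 : Finset (Fin m), ∀ S : Finset (Fin n),
      (∀ b ∉ 𝓢, (S.filter fun r => base r = b).card ≤ Nat.clog 2 (k + 1) + δ) →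
      ∑ i, a i * setCoeff S (Q.polyGate base w i) = 0 := by
    intro 𝓢
    induction 𝓢 using Finset.induction_on with
    | empty => exact fun S hS => h S fun b => hS b (by simp)
    | insert b 𝓢 hb ih =>
      intro S hS
      set Z := S.filter fun r => base r ≠ b with hZ
      have hread : ∀ i, ReadOnce Finset.univ fun (j : Fin (Q.fanin i)) r =>
          (MvPolynomial.C ((Q.lin i j).coef r) : MvPolynomial (Fin m) F) := by
        intro i j _ j' _ r h1 h2
        exact readOnce_of_hasBaseSetsDistance hQ i j j' r (by simpa using h1) (by simpa using h2)
      choose ε hε using fun i => exists_setCoeff_union_prod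
        (u := Q.shiftedConst base w i) (hread i) Z
      set J : ∀ i, Finset (Fin (Q.fanin i)) := fun i => Finset.univ.filter fun j =>
        ∀ r ∈ Z, (MvPolynomial.C ((Q.lin i j).coef r) : MvPolynomial (Fin m) F) = 0 with hJ
      -- The shifts in the other base sets count as constants; only the variables of `b` and their
      -- shifts remain visible to the one-variable theorem.
      let c : ∀ i, Fin (Q.fanin i) → MvPolynomial (Fin m) F := fun i j =>
        MvPolynomial.C (Q.lin i j).const + ∑ r, if base r = b then 0 else
          MvPolynomial.C ((Q.lin i j).coef r) * MvPolynomial.X (base r) ^ w r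
      let β : ∀ i, Fin (Q.fanin i) → Fin n → MvPolynomial (Fin m) F := fun i j r =>
        if base r = b then MvPolynomial.C ((Q.lin i j).coef r) else 0
      have hconst : ∀ i j, singleOut b (Q.shiftedConst base w i j) =
          Polynomial.C (c i j) + ∑ r, Polynomial.C (β i j r) * Polynomial.X ^ w r := by
        intro i j
        simp only [shiftedConst, c, β, map_add, map_sum, map_mul, map_pow, add_assoc]
        congr 1
        · simp [singleOut]
        · rw [← Finset.sum_add_distrib]
          refine Finset.sum_congr rfl fun r _ => ?_
          by_cases hr : base r = b <;> simp [singleOut, hr]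
      have hval : ∀ T : Finset (Fin n), (∀ r ∈ T, base r = b) →
          singleOut b (∑ i, a i * setCoeff (Z ∪ T) (Q.polyGate base w i)) =
          ∑ i, singleOut b (a i * ε i) * setCoeff T (shiftedProd w (J i) (c i) (β i)) := by
        intro T hT
        have hdis : Disjoint Z T := Finset.disjoint_left.2 fun r hr hrT =>
          (Finset.mem_filter.1 hr).2 (hT r hrT)
        rw [map_sum]
        refine Finset.sum_congr rfl fun i _ => ?_
        have h1 : setCoeff (Z ∪ T) (Q.polyGate base w i) = ε i * setCoeff T (∏ j ∈ J i,
            affine (Q.shiftedConst base w i j) fun r => MvPolynomial.C ((Q.lin i j).coef r)) := by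
          rw [polyGate, hε i T hdis]
          congr!
        rw [h1, ← mul_assoc, map_mul, ← setCoeff_map, map_prod]
        congr 1
        simp only [map_affine, hconst]
        rw [shiftedProd]
        refine setCoeff_prod_congr fun j _ r hr => ?_
        simp [β, hT r hr, singleOut]
      obtain ⟨e, P, hind, hdist⟩ := hQ b
      -- The frozen part `Z` enters only through the factors `ε i`, which may involve `t_b`; this is
      -- why the coefficients of the combination are allowed to be polynomials in `X`. Each base set
      -- may use its own order `e` of the gates.
      have hone := eq_zero_of_forall_card_le (l := Nat.clog 2 (k + 1)) hdist hδ
        (fun i => J (e i)) (fun i => c (e i)) (fun i => β (e i)) (w := w) (B := {r | base r = b})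
        (by
          intro i j _ j' _ r r' h1 h2
          refine hind i j j' r r' ?_ ?_
          · simp only [β] at h1
            simp only [restrict, LinForm.Present, LinForm.restrict, Set.mem_ofPred_eq]
            split_ifs at h1 ⊢ with h3
            · simpa using h1
            · exact absurd rfl h1
          · simp only [β] at h2
            simp only [restrict, LinForm.Present, LinForm.restrict, Set.mem_ofPred_eq]
            split_ifs at h2 ⊢ with h3
            · simpa using h2
            · exact absurd rfl h2)
        (by
          intro i j _ r h1
          by_contra h2
          exact h1 (if_neg h2))
        (fun S T hS hT => hw b S T hS hT) (Nat.le_pow_clog one_lt_two _)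
        (fun i => singleOut b (a (e i) * ε (e i)))
        (by
          intro T hT
          rw [Equiv.sum_comp e fun i =>
            singleOut b (a i * ε i) * setCoeff T (shiftedProd w (J i) (c i) (β i))]
          by_cases hTb : ∀ r ∈ T, base r = b
          · rw [← hval T hTb, ih, map_zero]
            intro b' hb'
            by_cases hbb : b' = b
            · refine (Finset.card_le_card fun r hr => ?_).trans hT
              obtain ⟨hr, hrb⟩ := Finset.mem_filter.1 hr
              refine (Finset.mem_union.1 hr).resolve_left fun hrZ => ?_
              exact (Finset.mem_filter.1 hrZ).2 (hrb.trans hbb)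
            · refine (Finset.card_le_card fun r hr => ?_).trans
                (hS b' (by simp [hbb, hb']))
              obtain ⟨hr, hrb⟩ := Finset.mem_filter.1 hr
              refine Finset.mem_filter.2 ⟨?_, hrb⟩
              rcases Finset.mem_union.1 hr with hr | hr
              · exact (Finset.mem_filter.1 hr).1
              · exact absurd (hrb.symm.trans (hTb r hr)) hbb
          · push Not at hTb
            obtain ⟨r, hr, hrb⟩ := hTb
            refine Finset.sum_eq_zero fun i _ => ?_
            rw [shiftedProd, setCoeff_prod_of_absent hr, mul_zero]
            intro j _
            simp [β, hrb])
        (S.filter fun r => base r = b)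
      rw [Equiv.sum_comp e fun i => singleOut b (a i * ε i) *
          setCoeff (S.filter fun r => base r = b) (shiftedProd w (J i) (c i) (β i)),
        ← hval _ (fun r hr => (Finset.mem_filter.1 hr).2)] at hone
      have hSu : Z ∪ S.filter (fun r => base r = b) = S := by
        rw [hZ, Finset.union_comm]
        exact Finset.filter_union_filter_not_eq _ S
      rw [hSu] at hone
      exact singleOut_injective b (by rw [hone, map_zero])
  exact key Finset.univ S (by simp)

/-- The dual form of the concentration: a combination of the shifted gates vanishes if its
coefficients of low support vanish. -/
theorem eq_zero_of_forall_support_card_le {δ : ℕ} {Q : Depth3Circuit F n k} {base : Fin n → Fin m}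
    {w : Fin n → ℕ} (hδ : 1 ≤ δ) (hQ : Q.HasBaseSetsDistance base δ)
    (hw : SeparatesBaseSets base w (δ * Nat.clog 2 (k + 1)))
    (a : Fin k → MvPolynomial (Fin m) F)
    (h : ∀ S : Finset (Fin n), S.card ≤ m * (Nat.clog 2 (k + 1) + δ) →
      ∑ i, a i * setCoeff S (Q.polyGate base w i) = 0)
    (S : Finset (Fin n)) : ∑ i, a i * setCoeff S (Q.polyGate base w i) = 0 := by
  classical
  refine eq_zero_of_forall_base_card_le hδ hQ hw a (fun S hS => h S ?_) S
  rw [Finset.card_eq_sum_card_fiberwise (f := base) (t := Finset.univ) (by simp [Set.MapsTo])]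
  refine (Finset.sum_le_sum fun b _ => ?_).trans_eq
    (b := ∑ _b : Fin m, (Nat.clog 2 (k + 1) + δ)) (by simp)
  convert hS b

theorem isConcentrated_shiftedGate {δ : ℕ} {Q : Depth3Circuit F n k} {base : Fin n → Fin m}
    {w : Fin n → ℕ} (hδ : 1 ≤ δ) (hQ : Q.HasBaseSetsDistance base δ)
    (hw : SeparatesBaseSets base w (δ * Nat.clog 2 (k + 1))) :
    IsConcentrated (Q.shiftedGate base w) (m * ((Nat.clog 2 (k + 1) + δ + 1) - 1) + 1) := by
  have hvec : ∀ S i, coefVec (Q.shiftedGate base w) S i =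
      algebraMap (MvPolynomial (Fin m) F) (ShiftField F m)
        (setCoeff S (Q.polyGate base w i)) := by
    intro S i
    rw [← setCoeff_map, ← shiftedGate_eq_map]
    rfl
  suffices hspan : Submodule.span (ShiftField F m)
      {u | ∃ S : Finset (Fin n), S.card < m * ((Nat.clog 2 (k + 1) + δ + 1) - 1) + 1 ∧
        coefVec (Q.shiftedGate base w) S = u} =
      Submodule.span (ShiftField F m) {u | ∃ S, coefVec (Q.shiftedGate base w) S = u} by
    rw [IsConcentrated, Set.finrank, Set.finrank, hspan]
  refine le_antisymm (Submodule.span_mono fun u ⟨S, _, hS⟩ => ⟨S, hS⟩) (Submodule.span_le.2 ?_)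
  rintro _ ⟨S, rfl⟩
  by_contra hS
  -- A functional that kills the low coefficient vectors but not that of `S`; with denominators
  -- cleared, it is a combination `a` of the gates.
  obtain ⟨f, hfS, hf⟩ := Submodule.exists_le_ker_of_notMem hS
  obtain ⟨d, hd⟩ := IsLocalization.exist_integer_multiples_of_finite
    (nonZeroDivisors (MvPolynomial (Fin m) F)) fun i : Fin k => f (Pi.single i 1)
  choose a ha using hd
  have hfa : ∀ T, algebraMap (MvPolynomial (Fin m) F) (ShiftField F m)
      (∑ i, a i * setCoeff T (Q.polyGate base w i)) =
      (d : MvPolynomial (Fin m) F) • f (coefVec (Q.shiftedGate base w) T) := by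
    intro T
    rw [LinearMap.pi_apply_eq_sum_univ f, map_sum, Finset.smul_sum]
    refine Finset.sum_congr rfl fun i _ => ?_
    have hsingle : (fun i' => if i = i' then 1 else 0 : Fin k → ShiftField F m) =
        Pi.single i 1 := by
      funext i'
      simp [Pi.single_apply, eq_comm]
    rw [map_mul, ha, hvec, smul_eq_mul, hsingle, Algebra.smul_def, Algebra.smul_def]
    ring
  have hinj : Function.Injective (algebraMap (MvPolynomial (Fin m) F) (ShiftField F m)) :=
    IsFractionRing.injective _ _
  have hlow : ∀ T : Finset (Fin n), T.card ≤ m * (Nat.clog 2 (k + 1) + δ) →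
      ∑ i, a i * setCoeff T (Q.polyGate base w i) = 0 := by
    intro T hT
    apply hinj
    have h0 : f (coefVec (Q.shiftedGate base w) T) = 0 :=
      LinearMap.mem_ker.1 (hf (Submodule.subset_span ⟨T, Nat.lt_succ_of_le hT, rfl⟩))
    rw [hfa, h0, map_zero, Algebra.smul_def, mul_zero]
  have hzero := eq_zero_of_forall_support_card_le hδ hQ hw a hlow S
  have h1 := hfa S
  rw [hzero, map_zero, Algebra.smul_def, eq_comm, mul_eq_zero] at h1
  rcases h1 with h1 | h1
  · exact nonZeroDivisors.coe_ne_zero d (hinj (by rw [h1, map_zero]))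
  · exact hfS h1

end Depth3Circuit

/-! ### Separating weights and the hitting set -/

/-- Every such set is the set of values of some function `Fin s → Option (Fin n)`. -/
theorem card_filter_card_le_le (n s : ℕ) :
    (Finset.univ.filter fun S : Finset (Fin n) => S.card ≤ s).card ≤ (n + 1) ^ s := by
  classical
  have h := Finset.card_le_card_of_surjOn
    (s := (Finset.univ : Finset (Fin s → Option (Fin n))))
    (t := Finset.univ.filter fun S : Finset (Fin n) => S.card ≤ s)
    (fun f => Finset.univ.filter fun r => ∃ i, f i = some r) (by
      intro S hS
      have hS : S.card ≤ s := by simpa using hS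
      refine ⟨fun i => S.toList[(i : ℕ)]?, by simp, ?_⟩
      ext r
      simp only [Finset.mem_filter, Finset.mem_univ, true_and]
      constructor
      · rintro ⟨i, hi⟩
        exact Finset.mem_toList.1 (List.mem_of_getElem? hi)
      · intro hr
        obtain ⟨i, hi⟩ := List.mem_iff_getElem?.1 (Finset.mem_toList.2 hr)
        have : i < S.toList.length := (List.getElem?_eq_some_iff.1 hi).1
        rw [Finset.length_toList] at this
        exact ⟨⟨i, this.trans_le hS⟩, hi⟩)
  simpa using h

theorem sum_two_pow_injective (n : ℕ) :
    Function.Injective fun S : Finset (Fin n) => ∑ r ∈ S, 2 ^ (r : ℕ) := by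
  intro S T h
  have h1 : ∀ S : Finset (Fin n), ∑ r ∈ S, 2 ^ (r : ℕ) = ∑ i ∈ S.map Fin.valEmbedding, 2 ^ i := by
    intro S; simp
  simp only [h1] at h
  exact Finset.map_injective _ (Finset.geomSum_injective le_rfl h)

theorem sum_two_pow_lt (n : ℕ) (S : Finset (Fin n)) : ∑ r ∈ S, 2 ^ (r : ℕ) < 2 ^ n := by
  have h1 : ∑ r ∈ S, 2 ^ (r : ℕ) = ∑ i ∈ S.map Fin.valEmbedding, 2 ^ i := by simp
  rw [h1]
  refine Nat.geomSum_lt le_rfl fun i hi => ?_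
  obtain ⟨r, _, rfl⟩ := Finset.mem_map.1 hi
  exact r.2

/-- A positive number that is divisible by all numbers up to `2 * N` is divisible by the central
binomial coefficient. -/
theorem centralBinom_dvd_of_forall_dvd {N M : ℕ} (hN : 0 < N) (hM : M ≠ 0)
    (h : ∀ q, 2 ≤ q → q ≤ 2 * N → q ∣ M) : N.centralBinom ∣ M := by
  rw [← Nat.factorization_prime_le_iff_dvd (Nat.centralBinom_ne_zero N) hM]
  intro p hp
  rw [← hp.pow_dvd_iff_le_factorization hM]
  rcases Nat.eq_zero_or_pos (N.centralBinom.factorization p) with h0 | h0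
  · simp [h0]
  · refine h _ ?_ ?_
    · exact hp.two_le.trans (Nat.le_self_pow h0.ne' p)
    · rw [Nat.centralBinom_eq_two_mul_choose]
      exact Nat.pow_factorization_choose_le (by omega)

/-- Some small modulus `q` makes the weights `2 ^ r % q` separate the sets of at most `s`
variables. -/
theorem exists_modulus (n s : ℕ) (hn : 1 ≤ n) (hs : 1 ≤ s) :
    ∃ q, 2 ≤ q ∧ q ≤ (n + 1) ^ (2 * s + 2) ∧ ∀ S T : Finset (Fin n), S.card ≤ s → T.card ≤ s →
      ∑ r ∈ S, 2 ^ (r : ℕ) % q = ∑ r ∈ T, 2 ^ (r : ℕ) % q → S = T := by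
  classical
  by_contra hcon
  push Not at hcon
  -- If all `q ≤ 2 * N` failed, each would divide a difference of two of the sums of `2 ^ r`, hence
  -- the product of all nonzero differences. There are at most `(n + 1) ^ (2 * s)` pairs with
  -- differences at most `2 ^ n`, so that product is at most `2 ^ N`, which is too small for a
  -- multiple of the central binomial coefficient.
  set N := (n + 1) ^ (2 * s + 1) with hN
  have hN8 : 8 ≤ N := by
    calc 8 = 2 ^ 3 := by norm_num
      _ ≤ (n + 1) ^ 3 := Nat.pow_le_pow_left (by omega) 3
      _ ≤ N := Nat.pow_le_pow_right (by omega) (by omega)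
  have h2N : 2 * N ≤ (n + 1) ^ (2 * s + 2) := by
    rw [pow_succ, mul_comm]
    exact Nat.mul_le_mul_left _ (by omega)
  let a : Finset (Fin n) → ℕ := fun S => ∑ r ∈ S, 2 ^ (r : ℕ)
  let C := Finset.univ.filter fun S : Finset (Fin n) => S.card ≤ s
  let pairs := (C ×ˢ C).filter fun p => p.1 ≠ p.2
  let D : Finset (Fin n) × Finset (Fin n) → ℕ := fun p => ((a p.1 : ℤ) - a p.2).natAbs
  have hD0 : ∀ p ∈ pairs, D p ≠ 0 := by
    intro p hp h0
    have : (a p.1 : ℤ) = a p.2 := by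
      have := Int.natAbs_eq_zero.1 h0
      omega
    exact (Finset.mem_filter.1 hp).2 (sum_two_pow_injective n (by exact_mod_cast this))
  have hDlt : ∀ p ∈ pairs, D p ≤ 2 ^ n := by
    intro p _
    have h1 : a p.1 < 2 ^ n := sum_two_pow_lt n p.1
    have h2 : a p.2 < 2 ^ n := sum_two_pow_lt n p.2
    simp only [D]
    omega
  have hdvd : N.centralBinom ∣ ∏ p ∈ pairs, D p := by
    refine centralBinom_dvd_of_forall_dvd (by omega) (Finset.prod_ne_zero_iff.2 hD0) ?_
    intro q hq hq'
    obtain ⟨S, T, hS, hT, hsum, hne⟩ := hcon q hq (hq'.trans h2N)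
    have hmem : (S, T) ∈ pairs := by simp [pairs, C, hS, hT, hne]
    refine dvd_trans ?_ (Finset.dvd_prod_of_mem D hmem)
    have hmod : a S ≡ a T [MOD q] := by
      simp only [a, Nat.ModEq]
      rw [Finset.sum_nat_mod, Finset.sum_nat_mod T, hsum]
    have := (Nat.modEq_iff_dvd.1 hmod.symm)
    exact Int.natCast_dvd.1 this
  have hcard : pairs.card ≤ (n + 1) ^ (2 * s) := by
    refine (Finset.card_filter_le _ _).trans ?_
    rw [Finset.card_product, two_mul, pow_add]
    exact Nat.mul_le_mul (card_filter_card_le_le n s) (card_filter_card_le_le n s)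
  have hle : N.centralBinom ≤ 2 ^ N := by
    refine (Nat.le_of_dvd (Nat.pos_of_ne_zero (Finset.prod_ne_zero_iff.2 hD0)) hdvd).trans ?_
    refine (Finset.prod_le_pow_card _ _ _ hDlt).trans ?_
    rw [← pow_mul]
    refine Nat.pow_le_pow_right (by norm_num) ?_
    rw [hN, pow_succ, mul_comm]
    exact Nat.mul_le_mul hcard (by omega)
  have h4 := Nat.four_pow_lt_mul_centralBinom N (by omega)
  have h5 : N * N.centralBinom ≤ 2 ^ N * 2 ^ N := Nat.mul_le_mul Nat.lt_two_pow_self.le hle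
  rw [← mul_pow] at h5
  norm_num at h5
  omega

/-- Digits of a number can be prescribed. -/
theorem exists_div_pow_mod_eq {B : ℕ} (hB : 0 < B) (d : ℕ → ℕ) (hd : ∀ b, d b < B) (v m : ℕ) :
    ∃ V, V / B ^ m = v ∧ ∀ b < m, V / B ^ b % B = d b := by
  induction m generalizing d with
  | zero => exact ⟨v, by simp, by simp⟩
  | succ m ih =>
    obtain ⟨V, hV, hVd⟩ := ih (fun b => d (b + 1)) fun b => hd _
    have hdiv : (d 0 + B * V) / B = V := by
      rw [Nat.add_mul_div_left _ _ hB, Nat.div_eq_of_lt (hd 0), zero_add]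
    refine ⟨d 0 + B * V, ?_, fun b hb => ?_⟩
    · rw [pow_succ', ← Nat.div_div_eq_div_mul, hdiv, hV]
    · rcases b with _ | b
      · simp [Nat.mod_eq_of_lt (hd 0)]
      · rw [pow_succ', ← Nat.div_div_eq_div_mul, hdiv, hVd b (by omega)]

/-! ### Encoding of the points by natural numbers. -/

namespace HittingSet

/-- The powers of `2` modulo `q`, computed without division. -/
def residue (q : ℕ) : ℕ → ℕ
  | 0 => 1
  | i + 1 => if q < residue q i + residue q i + 1 then residue q i + residue q i - q
      else residue q i + residue q i

/-- The case `q = 1`, in which `residue` is not the remainder, is needed: the program also meets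
this modulus, and the bound limits its running time. -/
theorem residue_le {q : ℕ} (hq : 1 ≤ q) (i : ℕ) : residue q i ≤ q := by
  induction i with
  | zero => exact hq
  | succ i ih => rw [residue]; split_ifs <;> omega

theorem residue_eq {q : ℕ} (hq : 2 ≤ q) (i : ℕ) : residue q i = 2 ^ i % q := by
  have hlt : ∀ i, residue q i < q := by
    intro i
    induction i with
    | zero => exact hq
    | succ i ih => rw [residue]; split_ifs <;> omega
  induction i with
  | zero => rw [residue, pow_zero, Nat.mod_eq_of_lt hq]
  | succ i ih =>
    have h1 : (2 ^ (i + 1)) % q = (residue q i + residue q i) % q := by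
      rw [pow_succ, mul_two, Nat.add_mod, ← ih]
    rw [h1, residue]
    have := hlt i
    split_ifs with h
    · rw [Nat.mod_eq_sub_mod (by omega), Nat.mod_eq_of_lt (by omega)]
    · rw [Nat.mod_eq_of_lt (by omega)]

variable {K : Type*} [Field K] {n m : ℕ}

open Classical in
/-- The point with number `Z`. The digits of `Z` in base `B` are a modulus, the numbers of the
values of the `m` shift variables, and a number whose digits in base `n + 1` are a set of
variables. -/
noncomputable def point (elem : ℕ → K) (base : Fin n → Fin m) (B Z : ℕ) (r : Fin n) : K :=
  elem (Z / B / B ^ (base r : ℕ) % B) ^ residue (Z % B + 1) r +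
    if ∃ j, Z / B / B ^ m / (n + 1) ^ j % (n + 1) = r + 1 then 1 else 0

theorem exists_point (elem : ℕ → K) (base : Fin n → Fin m) {B q M : ℕ} (hq : 1 ≤ q) (hqB : q ≤ B)
    (d : Fin m → ℕ) (hd : ∀ b, d b < B) (S : Finset (Fin n)) (hS : S.card ≤ M)
    (hM : (n + 1) ^ M ≤ B ^ m) : ∃ Z < B ^ (2 * m + 1), ∀ r, point elem base B Z r =
      elem (d (base r)) ^ residue q r + if r ∈ S then 1 else 0 := by
  classical
  have hB : 0 < B := by omega
  -- The variable `r` is coded by the digit `r + 1`, so that the digit `0` can fill the unused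
  -- places.
  obtain ⟨v, hv, hvd⟩ := exists_div_pow_mod_eq (B := n + 1) (by omega)
    (fun i => (S.toList[i]?).elim 0 fun r => (r : ℕ) + 1) (by
      intro i
      cases h : S.toList[i]? <;> simp) 0 M
  have hvlt : v < (n + 1) ^ M := (Nat.div_eq_zero_iff.1 hv).resolve_left (by positivity)
  obtain ⟨V, hV, hVd⟩ := exists_div_pow_mod_eq hB
    (fun b => if h : b < m then d ⟨b, h⟩ else 0) (by
      intro b
      by_cases h : b < m
      · simp [h, hd]
      · simp [h, hB]) v m
  have hVlt : V < B ^ (2 * m) := by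
    have h1 : V < (v + 1) * B ^ m := by
      exact (Nat.div_lt_iff_lt_mul (by positivity)).1 (by omega)
    calc V < (v + 1) * B ^ m := h1
      _ ≤ B ^ m * B ^ m := Nat.mul_le_mul_right _ (by omega)
      _ = B ^ (2 * m) := by rw [two_mul, pow_add]
  have hdiv : (q - 1 + B * V) / B = V := by
    rw [Nat.add_mul_div_left _ _ hB, Nat.div_eq_of_lt (by omega), zero_add]
  have hmod : (q - 1 + B * V) % B = q - 1 := by
    rw [Nat.add_mul_mod_self_left, Nat.mod_eq_of_lt (by omega)]
  refine ⟨q - 1 + B * V, ?_, fun r => ?_⟩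
  · calc q - 1 + B * V < B * (V + 1) := by rw [mul_add]; omega
      _ ≤ B * B ^ (2 * m) := Nat.mul_le_mul_left _ hVlt
      _ = B ^ (2 * m + 1) := (pow_succ' _ _).symm
  · rw [point, hdiv, hmod, hV, hVd _ (base r).2, Nat.sub_add_cancel hq]
    simp only [Fin.is_lt, dif_pos, Fin.eta]
    congr 2
    rw [eq_iff_iff]
    constructor
    · rintro ⟨j, hj⟩
      by_cases hjM : j < M
      · rw [hvd j hjM] at hj
        cases h : S.toList[j]? with
        | none => simp [h] at hj
        | some r' =>
          simp only [h, Option.elim_some, Nat.add_right_cancel_iff] at hj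
          rw [← Fin.ext hj]
          exact Finset.mem_toList.1 (List.mem_of_getElem? h)
      · rw [Nat.div_eq_of_lt (hvlt.trans_le (Nat.pow_le_pow_right (by omega) (by omega)))] at hj
        simp at hj
    · intro hr
      obtain ⟨j, hj⟩ := List.mem_iff_getElem?.1 (Finset.mem_toList.2 hr)
      have : j < S.toList.length := (List.getElem?_eq_some_iff.1 hj).1
      rw [Finset.length_toList] at this
      exact ⟨j, by rw [hvd j (this.trans_le hS), hj]; rfl⟩

end HittingSet

/-! ### Inverse shifts and evaluation at indicator points. -/

namespace AffineProduct

open MvPolynomial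

variable {A : Type*} [CommRing A] {n : ℕ}

theorem aeval_X_add_C_injective (b : Fin n → A) :
    Function.Injective (aeval (R := A) fun r : Fin n => (X r + C (b r) : MvPolynomial (Fin n) A)) := by
  have h : ∀ p : MvPolynomial (Fin n) A, aeval (R := A) (fun r : Fin n => X r + C (-b r))
      (aeval (R := A) (fun r : Fin n => X r + C (b r)) p) = p := by
    intro p
    induction p using MvPolynomial.induction_on with
    | C a => simp only [algHom_C, algebraMap_eq]
    | add p q hp hq => rw [map_add, map_add, hp, hq]
    | mul_X p r hp =>
      rw [map_mul, map_mul, hp, aeval_X, map_add, aeval_X, algHom_C, algebraMap_eq, add_assoc,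
        ← C_add, neg_add_cancel, C_0, add_zero]
  intro p q hpq
  rw [← h p, ← h q]
  exact congrArg _ hpq

-- At the indicator of `S` exactly the monomials dividing `x^S` survive, and only `x^S` itself has a
-- nonzero coefficient among them.
open Classical in
theorem eval_indicator_eq_setCoeff {p : MvPolynomial (Fin n) A} (hp : Multilin p)
    {S : Finset (Fin n)} (hS : ∀ T ⊂ S, setCoeff T p = 0) :
    eval (fun r => if r ∈ S then 1 else 0) p = setCoeff S p := by
  conv_lhs => rw [hp.eq_sum]
  simp only [map_sum, map_mul, map_prod, eval_C, eval_X]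
  rw [Finset.sum_eq_single S]
  · rw [Finset.prod_eq_one fun r hr => if_pos hr, mul_one]
  · intro T _ hne
    by_cases hT : T ⊆ S
    · rw [hS T (Finset.ssubset_iff_subset_ne.2 ⟨hT, hne⟩), zero_mul]
    · obtain ⟨r, hr, hrS⟩ := Finset.not_subset.1 hT
      rw [Finset.prod_eq_zero hr (if_neg hrS), mul_zero]
  · simp

end AffineProduct

/-! ### Nonvanishing of the circuit on the encoded points. -/

namespace Depth3Circuit

open AffineProduct MvPolynomial

variable {F : Type*} [Field F] {n k m : ℕ}

theorem polyGate_eq_aeval (Q : Depth3Circuit F n k) (base : Fin n → Fin m) (w : Fin n → ℕ)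
    (i : Fin k) : Q.polyGate base w i =
      aeval (R := MvPolynomial (Fin m) F) (fun r => X r + C (X (base r) ^ w r)) (map C (Q.gate i)) := by
  rw [polyGate, gate, map_prod, map_prod]
  refine Finset.prod_congr rfl fun j _ => ?_
  have : (Q.lin i j).poly = affine (Q.lin i j).const (Q.lin i j).coef := rfl
  rw [this, map_affine, aeval_affine, shiftedConst]

theorem eval_aeval_X_add_C (b e : Fin n → MvPolynomial (Fin m) F) (q : MvPolynomial (Fin n) F) :
    eval e (aeval (R := MvPolynomial (Fin m) F) (fun r => X r + C (b r)) (map C q)) =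
      aeval (fun r => b r + e r) q := by
  induction q using MvPolynomial.induction_on with
  | C a => simp only [map_C, algHom_C, algebraMap_eq, eval_C]
  | add p q hp hq => rw [map_add, map_add, map_add, map_add, hp, hq]
  | mul_X p r hp =>
    rw [map_mul, map_mul, map_mul, map_mul, hp, map_X, aeval_X, aeval_X, map_add, eval_X, eval_C,
      add_comm (e r)]

/-- The polynomial computed by the circuit after the shift. -/
noncomputable def shiftedPoly (Q : Depth3Circuit F n k) (base : Fin n → Fin m) (w : Fin n → ℕ) :
    MvPolynomial (Fin n) (MvPolynomial (Fin m) F) :=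
  aeval (R := MvPolynomial (Fin m) F) (fun r => X r + C (X (base r) ^ w r)) (map C Q.poly)

theorem shiftedPoly_eq_sum (Q : Depth3Circuit F n k) (base : Fin n → Fin m) (w : Fin n → ℕ) :
    Q.shiftedPoly base w = ∑ i, C (C (Q.weight i)) * Q.polyGate base w i := by
  rw [shiftedPoly, poly, map_sum, map_sum]
  refine Finset.sum_congr rfl fun i _ => ?_
  rw [map_mul, map_mul, map_C, algHom_C, algebraMap_eq, polyGate_eq_aeval]

theorem shiftedPoly_ne_zero {Q : Depth3Circuit F n k} (base : Fin n → Fin m) (w : Fin n → ℕ)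
    (h0 : Q.poly ≠ 0) : Q.shiftedPoly base w ≠ 0 := by
  intro h
  have h1 : map (C : F →+* MvPolynomial (Fin m) F) Q.poly = 0 :=
    aeval_X_add_C_injective (fun r => X (base r) ^ w r) (h.trans (map_zero _).symm)
  have h2 : Function.Injective (C : F →+* MvPolynomial (Fin m) F) := C_injective _ _
  exact h0 (map_injective _ h2 (h1.trans (map_zero _).symm))

theorem multilin_shiftedPoly {δ : ℕ} {Q : Depth3Circuit F n k} {base : Fin n → Fin m}
    (hQ : Q.HasBaseSetsDistance base δ) (w : Fin n → ℕ) : Multilin (Q.shiftedPoly base w) := by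
  rw [shiftedPoly_eq_sum]
  exact Multilin.sum fun i _ => (multilin_prod fun j _ j' _ r h1 h2 =>
    readOnce_of_hasBaseSetsDistance hQ i j j' r (by simpa using h1) (by simpa using h2)).C_mul _

/-- The circuit is the combination of its gates with the weights as coefficients, so the dual form
of concentration applies directly. -/
theorem exists_setCoeff_shiftedPoly_ne_zero {δ : ℕ} {Q : Depth3Circuit F n k}
    {base : Fin n → Fin m} {w : Fin n → ℕ} (hδ : 1 ≤ δ) (hQ : Q.HasBaseSetsDistance base δ)
    (hw : SeparatesBaseSets base w (δ * Nat.clog 2 (k + 1))) (h0 : Q.poly ≠ 0) :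
    ∃ S : Finset (Fin n), S.card ≤ m * (Nat.clog 2 (k + 1) + δ) ∧
      setCoeff S (Q.shiftedPoly base w) ≠ 0 := by
  have hcoef : ∀ S, setCoeff S (Q.shiftedPoly base w) =
      ∑ i, C (Q.weight i) * setCoeff S (Q.polyGate base w i) := by
    intro S
    rw [shiftedPoly_eq_sum, setCoeff_sum]
    simp only [setCoeff_C_mul]
  by_contra hcon
  push Not at hcon
  refine shiftedPoly_ne_zero base w h0 ?_
  rw [(multilin_shiftedPoly hQ w).eq_sum]
  refine Finset.sum_eq_zero fun S _ => ?_
  rw [hcoef, eq_zero_of_forall_support_card_le hδ hQ hw (fun i => C (Q.weight i))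
    (fun T hT => by rw [← hcoef, hcon T hT]) S, C_0, zero_mul]

open Classical in
/-- Some `0`-`1` point of low support, shifted, is not a zero of the circuit. -/
theorem exists_eval_shift_ne_zero {δ : ℕ} {Q : Depth3Circuit F n k} {base : Fin n → Fin m}
    {w : Fin n → ℕ} (hδ : 1 ≤ δ) (hQ : Q.HasBaseSetsDistance base δ)
    (hw : SeparatesBaseSets base w (δ * Nat.clog 2 (k + 1))) (h0 : Q.poly ≠ 0) :
    ∃ S : Finset (Fin n), S.card ≤ m * (Nat.clog 2 (k + 1) + δ) ∧
      aeval (fun r => X (base r) ^ w r + if r ∈ S then 1 else 0 : Fin n → MvPolynomial (Fin m) F)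
        Q.poly ≠ 0 := by
  obtain ⟨S₀, hS₀, hS₀ne⟩ := exists_setCoeff_shiftedPoly_ne_zero hδ hQ hw h0
  -- Minimal size makes the coefficients of all proper subsets vanish, as evaluation at the
  -- indicator requires.
  obtain ⟨S, hS, hmin⟩ := Finset.exists_min_image
    (Finset.univ.filter fun S : Finset (Fin n) => setCoeff S (Q.shiftedPoly base w) ≠ 0) Finset.card
    ⟨S₀, by simp [hS₀ne]⟩
  have hSne := (Finset.mem_filter.1 hS).2
  refine ⟨S, (hmin S₀ (by simp [hS₀ne])).trans hS₀, ?_⟩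
  rw [← eval_indicator_eq_setCoeff (multilin_shiftedPoly hQ w) (S := S) (fun T hT => by
    by_contra hne
    exact (Finset.card_lt_card hT).not_ge (hmin T (by simp [hne])))] at hSne
  rwa [shiftedPoly, eval_aeval_X_add_C] at hSne

theorem degreeOf_aeval_le {q : MvPolynomial (Fin n) F} (hq : Multilin q) (b : Fin m) (N : ℕ)
    (y : Fin n → MvPolynomial (Fin m) F) (hy : ∀ r, (y r).degreeOf b ≤ N) :
    (aeval y q).degreeOf b ≤ n * N := by
  rw [hq.eq_sum, map_sum]
  refine (degreeOf_sum_le _ _ _).trans (Finset.sup_le fun S _ => ?_)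
  rw [map_mul, algHom_C, algebraMap_eq, map_prod]
  refine (degreeOf_C_mul_le _ _ _).trans ((degreeOf_prod_le _ _ _).trans ?_)
  simp only [aeval_X]
  refine (Finset.sum_le_card_nsmul _ _ N fun r _ => hy r).trans ?_
  rw [smul_eq_mul]
  exact Nat.mul_le_mul_right _ (by simpa using Finset.card_le_univ S)

/-- The points with numbers below `B ^ (2 * m + 1)` form a hitting set. -/
theorem exists_point_ne_zero {K : Type*} [Field K] [Algebra F K] {δ B : ℕ}
    (hB : B = (n + 1) ^ (5 * (δ * Nat.clog 2 (k + 1)))) {elem : ℕ → K}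
    (helem : Set.InjOn elem (Set.Iio B)) {Q : Depth3Circuit F n k} {base : Fin n → Fin m}
    (hn : 1 ≤ n) (hk : 1 ≤ k) (hδ : 1 ≤ δ) (hml : Q.IsMultilinear)
    (hQ : Q.HasBaseSetsDistance base δ) (h0 : Q.poly ≠ 0) :
    ∃ Z < B ^ (2 * m + 1), aeval (HittingSet.point elem base B Z) Q.poly ≠ 0 := by
  classical
  have hl : 1 ≤ Nat.clog 2 (k + 1) := Nat.clog_pos one_lt_two (by omega)
  set l := Nat.clog 2 (k + 1) with hl'
  set s := δ * l with hs
  have hs1 : 1 ≤ s := Nat.mul_pos hδ hl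
  obtain ⟨q, hq2, hq, hsep⟩ := exists_modulus n s hn hs1
  set w : Fin n → ℕ := fun r => HittingSet.residue q r with hw
  have hwsep : SeparatesBaseSets base w s := by
    intro b S T _ _ hS hT hsum
    refine hsep S T hS hT ?_
    simpa only [hw, HittingSet.residue_eq hq2] using hsum
  obtain ⟨S, hS, hne⟩ := exists_eval_shift_ne_zero hδ hQ hwsep h0
  set y : Fin n → MvPolynomial (Fin m) F :=
    fun r => X (base r) ^ w r + if r ∈ S then 1 else 0 with hy
  have hdeg : ∀ b, (aeval y Q.poly).degreeOf b ≤ n * q := by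
    intro b
    refine degreeOf_aeval_le (multilin_iff_degreeOf.2 hml.2.2) b q y fun r => ?_
    refine (degreeOf_add_le _ _ _).trans (max_le ?_ ?_)
    · refine (degreeOf_pow_le _ _ _).trans ?_
      refine (Nat.mul_le_mul (HittingSet.residue_le (by omega) r)
        (?_ : _ ≤ 1)).trans (by omega)
      rw [degreeOf_X]
      split_ifs <;> omega
    · split_ifs <;> simp [degreeOf_one]
  -- The exponent `5 * s` of `B` suffices because `2 * s + 3 ≤ 5 * s`; the degree in each shift
  -- variable is then below the number of available field elements.
  have hnq : n * q < B := by
    calc n * q ≤ n * (n + 1) ^ (2 * s + 2) := Nat.mul_le_mul_left _ hq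
      _ < (n + 1) * (n + 1) ^ (2 * s + 2) := Nat.mul_lt_mul_of_pos_right (by omega) (by positivity)
      _ = (n + 1) ^ (2 * s + 3) := (pow_succ' _ _).symm
      _ ≤ B := by rw [hB]; exact Nat.pow_le_pow_right (by omega) (by omega)
  have hinj : Function.Injective (algebraMap F K) := (algebraMap F K).injective
  have hmapne : map (algebraMap F K) (aeval y Q.poly) ≠ 0 := by
    intro h
    exact hne (map_injective _ hinj (by rw [h, map_zero]))
  obtain ⟨τ, hτ, hτne⟩ : ∃ τ : Fin m → K, (∀ b, τ b ∈ (Finset.range B).image elem) ∧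
      eval τ (map (algebraMap F K) (aeval y Q.poly)) ≠ 0 := by
    by_contra hcon
    push Not at hcon
    refine hmapne (eq_zero_of_eval_zero_at_prod_finset _ (fun _ => (Finset.range B).image elem)
      (fun b => ?_) hcon)
    rw [Finset.card_image_of_injOn (by simpa [Set.InjOn] using helem), Finset.card_range]
    refine lt_of_le_of_lt ?_ hnq
    refine le_trans ?_ (hdeg b)
    exact degreeOf_le_iff.2 fun e he => degreeOf_le_iff.1 le_rfl e (support_map_subset _ _ he)
  choose d hd hdτ using fun b => Finset.mem_image.1 (hτ b)
  obtain ⟨Z, hZ, hpt⟩ := HittingSet.exists_point elem base (B := B) (q := q) (by omega)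
    (by nlinarith) d (fun b => Finset.mem_range.1 (hd b)) S hS (by
      rw [hB, ← pow_mul]
      refine Nat.pow_le_pow_right (by omega) ?_
      -- Both `l` and `δ` are at least `1`, so each is at most `s = δ * l`; hence `m` digits to base
      -- `B` have room for the code of the support.
      have : l + δ ≤ 2 * s := by nlinarith
      nlinarith)
  refine ⟨Z, hZ, ?_⟩
  convert hτne using 1
  rw [eval_map]
  have : ∀ p : MvPolynomial (Fin n) F, aeval (HittingSet.point elem base B Z) p =
      eval₂ (algebraMap F K) τ (aeval y p) := by
    intro p
    induction p using MvPolynomial.induction_on with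
    | C a => simp [algebraMap_eq]
    | add p q hp hq => rw [map_add, map_add, eval₂_add, hp, hq]
    | mul_X p r hp =>
      rw [map_mul, map_mul, eval₂_mul, hp, aeval_X, aeval_X, hpt, hy]
      simp only [eval₂_add, eval₂_pow, eval₂_X, hdτ, hw]
      congr 2
      split_ifs <;> simp
  exact this Q.poly

end Depth3Circuit

/-! ### Running time of structured programs -/

namespace FieldRAM

section Run

variable {K : Type*} [Field K] {elem : ℕ → K}

/-- The program `p` takes the state `s` to the state `s'` within `t` steps. -/
def Run (elem : ℕ → K) (p : Prog) (t : ℕ) (s s' : State K) : Prop :=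
  ∃ t' ≤ t, Exec elem p s t' s'

theorem Run.mono {p : Prog} {t t' : ℕ} {s s' : State K} (h : Run elem p t s s') (ht : t ≤ t') :
    Run elem p t' s s' :=
  let ⟨u, hu, he⟩ := h
  ⟨u, hu.trans ht, he⟩

theorem Run.skip (s : State K) : Run elem .skip 1 s s := ⟨1, le_rfl, .skip s⟩

theorem Run.seq {p q : Prog} {t t' : ℕ} {s s' s'' : State K} (h : Run elem p t s s')
    (h' : Run elem q t' s' s'') : Run elem (.seq p q) (t + t' + 1) s s'' :=
  let ⟨_, hu, he⟩ := h
  let ⟨_, hu', he'⟩ := h'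
  ⟨_, by omega, .seq he he'⟩

theorem Run.ite_true {a b : NExp} {p q : Prog} {t : ℕ} {s s' : State K}
    (h : a.eval s.mem < b.eval s.mem) (hp : Run elem p t s s') :
    Run elem (.ite a b p q) (a.cost + b.cost + t + 1) s s' :=
  let ⟨_, hu, he⟩ := hp
  ⟨_, by omega, .ite_true h he⟩

theorem Run.ite_false {a b : NExp} {p q : Prog} {t : ℕ} {s s' : State K}
    (h : ¬ a.eval s.mem < b.eval s.mem) (hq : Run elem q t s s') :
    Run elem (.ite a b p q) (a.cost + b.cost + t + 1) s s' :=
  let ⟨_, hu, he⟩ := hq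
  ⟨_, by omega, .ite_false h he⟩

/-- A loop with the intermediate states `σ 0, …, σ N`. -/
theorem Run.loop {a b : NExp} {p : Prog} {c : ℕ} (σ : ℕ → State K) (N : ℕ)
    (htest : ∀ i < N, a.eval (σ i).mem < b.eval (σ i).mem)
    (hend : ¬ a.eval (σ N).mem < b.eval (σ N).mem)
    (hbody : ∀ i < N, Run elem p c (σ i) (σ (i + 1))) :
    Run elem (.while a b p) (N * (a.cost + b.cost + c + 1) + (a.cost + b.cost + 1))
      (σ 0) (σ N) := by
  induction N generalizing σ with
  | zero => exact ⟨_, by omega, .while_false hend⟩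
  | succ N ih =>
    obtain ⟨u, hu, he⟩ := hbody 0 (by omega)
    obtain ⟨u', hu', he'⟩ := ih (fun i => σ (i + 1)) (fun i hi => htest _ (by omega)) hend
      (fun i hi => hbody _ (by omega))
    refine ⟨_, ?_, .while_true (htest 0 (by omega)) he he'⟩
    rw [add_mul, one_mul]
    omega

end Run

/-! ### Registers above the input -/

/-- The contents of the registers of the program. -/
structure Regs where
  B : ℕ
  T : ℕ
  Z : ℕ
  r : ℕ
  V : ℕ
  y : ℕ
  i : ℕ
  j : ℕ
  v : ℕ
  fl : ℕ
  w : ℕ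
  q : ℕ
  P : ℕ

namespace Regs

def get (ρ : Regs) : ℕ → ℕ
  | 0 => ρ.B
  | 1 => ρ.T
  | 2 => ρ.Z
  | 3 => ρ.r
  | 4 => ρ.V
  | 5 => ρ.y
  | 6 => ρ.i
  | 7 => ρ.j
  | 8 => ρ.v
  | 9 => ρ.fl
  | 10 => ρ.w
  | 11 => ρ.q
  | 12 => ρ.P
  | _ => 0

def set (ρ : Regs) (a x : ℕ) : Regs :=
  match a with
  | 0 => { ρ with B := x }
  | 1 => { ρ with T := x }
  | 2 => { ρ with Z := x }
  | 3 => { ρ with r := x }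
  | 4 => { ρ with V := x }
  | 5 => { ρ with y := x }
  | 6 => { ρ with i := x }
  | 7 => { ρ with j := x }
  | 8 => { ρ with v := x }
  | 9 => { ρ with fl := x }
  | 10 => { ρ with w := x }
  | 11 => { ρ with q := x }
  | 12 => { ρ with P := x }
  | _ => ρ

theorem get_set (ρ : Regs) {a : ℕ} (ha : a < 13) (x b : ℕ) :
    (ρ.set a x).get b = if b = a then x else ρ.get b := by
  by_cases hb : b < 13
  · interval_cases a <;> interval_cases b <;> rfl
  · obtain ⟨b, rfl⟩ : ∃ c, b = c + 13 := ⟨b - 13, by omega⟩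
    rw [if_neg (by omega)]
    interval_cases a <;> rfl

end Regs

section Store

variable {K : Type*} [Field K]

/-- The state with input `inp` in the cells below `n + 4`, the registers above them, and one
field element. -/
def store (inp : ℕ → ℕ) (n : ℕ) (ρ : Regs) (f : K) (out : List K) : State K where
  mem a := if a < n + 4 then inp a else ρ.get (a - (n + 4))
  fmem a := if a = 0 then f else 0
  out := out

/-- The address of the `a`-th register. -/
def adr (a : ℕ) : NExp := .add (.read (.const 0)) (.const (4 + a))

/-- The content of the `a`-th register. -/
def reg (a : ℕ) : NExp := .read (adr a)

/-- The content of the `a`-th input cell. -/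
def input (a : ℕ) : NExp := .read (.const a)

variable {inp : ℕ → ℕ} {n : ℕ} {ρ : Regs} {f : K} {out : List K}

theorem eval_adr (h0 : inp 0 = n) (a : ℕ) : (adr a).eval (store inp n ρ f out).mem = n + 4 + a := by
  simp [adr, NExp.eval, store, h0, add_assoc]

theorem eval_reg (h0 : inp 0 = n) (a : ℕ) :
    (reg a).eval (store inp n ρ f out).mem = ρ.get a := by
  have := eval_adr (ρ := ρ) (f := f) (out := out) h0 a
  simp only [reg, NExp.eval, this]
  simp [store]

theorem eval_input {a : ℕ} (ha : a < 4) :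
    (input a).eval (store inp n ρ f out).mem = inp a := by
  change (if a < n + 4 then inp a else ρ.get (a - (n + 4))) = inp a
  exact if_pos (by omega)

@[simp] theorem cost_adr (a : ℕ) : (adr a).cost = 4 := rfl

@[simp] theorem cost_reg (a : ℕ) : (reg a).cost = 5 := rfl

@[simp] theorem cost_input (a : ℕ) : (input a).cost = 2 := rfl

variable {elem : ℕ → K}

/-- Assignment to a register. -/
theorem run_set (h0 : inp 0 = n) {a : ℕ} (ha : a < 13) {e : NExp} {x : ℕ}
    (he : e.eval (store inp n ρ f out).mem = x) :
    Run elem (.setN (adr a) e) (e.cost + 5) (store inp n ρ f out)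
      (store inp n (ρ.set a x) f out) := by
  refine ⟨(adr a).cost + e.cost + 1, ?_, ?_⟩
  rotate_left
  · convert Exec.setN (elem := elem) (adr a) e (store inp n ρ f out) using 1
    rw [eval_adr h0, he]
    simp only [store, State.mk.injEq, and_true]
    funext b
    rw [Function.update_apply]
    by_cases hb : b < n + 4
    · rw [if_pos hb, if_neg (by omega), if_pos hb]
    · rw [if_neg hb, ρ.get_set ha]
      by_cases hba : b = n + 4 + a
      · rw [if_pos (by omega), if_pos hba]
      · rw [if_neg (by omega), if_neg hba, if_neg hb]
  · simp only [cost_adr]; omega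

theorem run_setF {x : FExp} {g : K} (hx : x.eval elem (store inp n ρ f out) = g) :
    Run elem (.setF (.const 0) x) (x.cost + 2) (store inp n ρ f out) (store inp n ρ g out) := by
  refine ⟨(NExp.const 0).cost + x.cost + 1, ?_, ?_⟩
  rotate_left
  · convert Exec.setF (elem := elem) (.const 0) x (store inp n ρ f out) using 1
    rw [hx]
    simp only [store, State.mk.injEq, and_true, true_and, NExp.eval]
    funext b
    rw [Function.update_apply]
    split_ifs <;> rfl
  · simp only [NExp.cost]; omega

theorem run_emit {x : FExp} {g : K} (hx : x.eval elem (store inp n ρ f out) = g) :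
    Run elem (.emit x) (x.cost + 1) (store inp n ρ f out) (store inp n ρ f (out ++ [g])) :=
  ⟨_, le_rfl, by
    have := Exec.emit (elem := elem) x (store inp n ρ f out)
    rwa [hx] at this⟩

end Store

end FieldRAM

namespace FieldRAM

/-! ### The program that prints one coordinate -/

section Subroutines

variable {K : Type*} [Field K] {elem : ℕ → K} {inp : ℕ → ℕ} {n : ℕ} {ρ : Regs} {f : K}
  {out : List K}

def assign (a : ℕ) (e : NExp) : Prog := .setN (adr a) e

def incr (a : ℕ) : Prog := assign a (.add (reg a) (.const 1))

/-- Division of register `V` by the value of `D`: the quotient goes to `y`, the remainder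
stays in `V`. -/
def divBy (D : NExp) : Prog :=
  .seq (assign 5 (.const 0)) (.while D (.add (reg 4) (.const 1))
    (.seq (assign 4 (.sub (reg 4) D)) (incr 5)))

/-- After `i` rounds `V` has lost `d * i` and `y` is `i`; the strict test `D < V + 1` expresses `D ≤
V`. The value of `D` must not depend on the two registers that change. -/
theorem run_divBy (h0 : inp 0 = n) {D : NExp} {d : ℕ} (hd : 0 < d) (hc : D.cost ≤ 5)
    (hD : ∀ V y, D.eval (store inp n { ρ with V := V, y := y } f out).mem = d) :
    Run elem (divBy D) (50 * ρ.V + 50) (store inp n ρ f out)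
      (store inp n { ρ with V := ρ.V % d, y := ρ.V / d } f out) := by
  have hN : ∀ i < ρ.V / d, d * i + d ≤ ρ.V := by
    intro i hi
    have h1 : d * (i + 1) ≤ d * (ρ.V / d) := Nat.mul_le_mul_left d hi
    have h2 := Nat.mul_div_le ρ.V d
    rw [mul_add, mul_one] at h1
    omega
  have hmod : ρ.V % d = ρ.V - d * (ρ.V / d) := by
    have := Nat.mod_add_div ρ.V d; omega
  have hlt := Nat.mod_lt ρ.V hd
  have hloop := Run.loop (elem := elem) (a := D) (b := .add (reg 4) (.const 1))
    (p := .seq (assign 4 (.sub (reg 4) D)) (incr 5))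
    (fun i => store inp n { ρ with V := ρ.V - d * i, y := i } f out) (ρ.V / d)
    (by
      intro i hi
      simp only [NExp.eval, eval_reg h0, hD, Regs.get]
      have := hN i hi
      omega)
    (by
      simp only [NExp.eval, eval_reg h0, hD, Regs.get]
      omega)
    (fun i hi => Run.seq
      (run_set h0 (x := ρ.V - d * (i + 1)) (by norm_num) (by
        simp only [NExp.eval, eval_reg h0, hD, Regs.get, mul_add, mul_one, Nat.sub_sub]))
      (run_set h0 (x := i + 1) (by norm_num) (by
        simp only [NExp.eval, eval_reg h0, Regs.get, Regs.set])))
  have h := Run.seq (run_set (elem := elem) (ρ := ρ) (f := f) (out := out) h0 (a := 5)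
    (e := .const 0) (x := 0) (by norm_num) rfl) hloop
  rw [hmod]
  refine Run.mono h ?_
  have hle : ρ.V / d ≤ ρ.V := Nat.div_le_self _ _
  simp only [NExp.cost, cost_reg]
  have : ρ.V / d * (D.cost + (5 + 1 + 1) + (5 + D.cost + 1 + 5 + (5 + 1 + 1 + 5) + 1) + 1) ≤
      ρ.V * 50 := Nat.mul_le_mul hle (by omega)
  omega

/-- Removal of the last digit of register `V` to the base that is the value of `D`. -/
def nextDigit (D : NExp) : Prog :=
  .seq (divBy D) (.seq (assign 4 (reg 5)) (assign 5 (.const 0)))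

theorem run_nextDigit (h0 : inp 0 = n) {D : NExp} {d : ℕ} (hd : 0 < d) (hc : D.cost ≤ 5)
    (hD : ∀ V y, D.eval (store inp n { ρ with V := V, y := y } f out).mem = d) :
    Run elem (nextDigit D) (50 * ρ.V + 80) (store inp n ρ f out)
      (store inp n { ρ with V := ρ.V / d, y := 0 } f out) := by
  refine Run.mono (Run.seq (run_divBy h0 hd hc hD) (Run.seq
    (run_set h0 (x := ρ.V / d) (by norm_num) (by simp only [eval_reg h0, Regs.get]))
    (run_set h0 (x := 0) (by norm_num) rfl))) ?_
  simp only [NExp.cost, cost_reg]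
  omega

/-- Removal of digits to the base `B`, while `i` is less than the value of `lim`. -/
def dropDigits (lim : NExp) : Prog :=
  .while (reg 6) lim (.seq (nextDigit (reg 0)) (incr 6))

/-- The counter may start at any `i ≤ L`, so that a second call can resume after one digit has been
read. -/
theorem run_dropDigits (h0 : inp 0 = n) {lim : NExp} {L W : ℕ} (hc : lim.cost ≤ 8)
    (hlim : ∀ V i, lim.eval (store inp n { ρ with V := V, i := i } f out).mem = L)
    (hB : 0 < ρ.B) (hy : ρ.y = 0) (hi : ρ.i ≤ L) (hV : ρ.V ≤ W) (hL : L ≤ W) (hW : 1 ≤ W) :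
    Run elem (dropDigits lim) (200 * (W * W)) (store inp n ρ f out)
      (store inp n { ρ with V := ρ.V / ρ.B ^ (L - ρ.i), i := L } f out) := by
  obtain ⟨B, T, Z, r, V, y, i, j, v, fl, w, q, P⟩ := ρ
  dsimp only at *
  subst hy
  have hloop := Run.loop (elem := elem) (a := reg 6) (b := lim)
    (p := .seq (nextDigit (reg 0)) (incr 6)) (c := 50 * W + 100)
    (fun t => store inp n ⟨B, T, Z, r, V / B ^ t, 0, i + t, j, v, fl, w, q, P⟩ f out) (L - i)
    (by
      intro t ht
      rw [hlim, eval_reg h0]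
      change i + t < L
      omega)
    (by
      rw [hlim, eval_reg h0]
      change ¬ i + (L - i) < L
      omega)
    (fun t ht => by
      have e : V / B ^ (t + 1) = V / B ^ t / B := by rw [pow_succ, Nat.div_div_eq_div_mul]
      simp only [e]
      refine Run.mono (Run.seq (run_nextDigit (d := B) h0 hB (by simp) (fun V y => by
        simp only [eval_reg h0, Regs.get])) (run_set h0 (x := i + (t + 1)) (by norm_num) (by
        simp only [NExp.eval, eval_reg h0, Regs.get, add_assoc]))) ?_
      simp only [NExp.cost, cost_reg]
      have : V / B ^ t ≤ W := (Nat.div_le_self _ _).trans hV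
      omega)
  rw [show i + (L - i) = L by omega] at hloop
  simp only [pow_zero, Nat.div_one, add_zero] at hloop
  refine Run.mono hloop ?_
  simp only [cost_reg]
  have : (L - i) * (5 + lim.cost + (50 * W + 100) + 1) ≤ W * (50 * W + 114) :=
    Nat.mul_le_mul (by omega) (by omega)
  nlinarith

open Classical in
/-- Whether `x` is one of the last `t` digits of `X` to the base `b`. -/
noncomputable def digitFlag (b X x t : ℕ) : ℕ := if ∃ j < t, X / b ^ j % b = x then 1 else 0

theorem digitFlag_zero (b X x : ℕ) : digitFlag b X x 0 = 0 := by simp [digitFlag]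

theorem digitFlag_succ_of_eq {b X x t : ℕ} (h : X / b ^ t % b = x) : digitFlag b X x (t + 1) = 1 :=
  if_pos ⟨t, by omega, h⟩

theorem digitFlag_succ_of_ne {b X x t : ℕ} (h : X / b ^ t % b ≠ x) :
    digitFlag b X x (t + 1) = digitFlag b X x t := by
  have : (∃ j < t + 1, X / b ^ j % b = x) ↔ ∃ j < t, X / b ^ j % b = x := by
    constructor
    · rintro ⟨j, hj, e⟩
      refine ⟨j, ?_, e⟩
      rcases (Nat.lt_succ_iff.1 hj).lt_or_eq with h1 | h1
      · exact h1
      · exact absurd (h1 ▸ e) h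
    · rintro ⟨j, hj, e⟩
      exact ⟨j, by omega, e⟩
  simp only [digitFlag, this]

/-- Strict comparison being the only test, equality of `V` and `r + 1` is found by excluding both
inequalities. -/
def flagTest : Prog :=
  .ite (reg 4) (.add (reg 3) (.const 1)) .skip
    (.ite (.add (reg 3) (.const 1)) (reg 4) .skip (assign 9 (.const 1)))

theorem run_flagTest (h0 : inp 0 = n) :
    Run elem flagTest 40 (store inp n ρ f out)
      (store inp n { ρ with fl := if ρ.V = ρ.r + 1 then 1 else ρ.fl } f out) := by
  have hr : (NExp.add (reg 3) (.const 1)).eval (store inp n ρ f out).mem = ρ.r + 1 := by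
    simp only [NExp.eval, eval_reg h0, Regs.get]
  have hV : (reg 4).eval (store inp n ρ f out).mem = ρ.V := by
    simp only [eval_reg h0, Regs.get]
  rcases lt_trichotomy ρ.V (ρ.r + 1) with h | h | h
  · rw [if_neg (by omega)]
    exact (Run.ite_true (by rw [hr, hV]; exact h) (Run.skip _)).mono (by simp [NExp.cost])
  · rw [if_pos h]
    exact (Run.ite_false (by rw [hr, hV]; omega) (Run.ite_false (by rw [hr, hV]; omega)
      (run_set h0 (x := 1) (by norm_num) rfl))).mono (by simp [NExp.cost])
  · rw [if_neg (by omega)]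
    exact (Run.ite_false (by rw [hr, hV]; omega) (Run.ite_true (by rw [hr, hV]; omega)
      (Run.skip _))).mono (by simp [NExp.cost])

/-- The search for `r + 1` among the digits of `V` to the base `n + 1`. -/
def flagLoop : Prog :=
  .while (reg 6) (reg 1) (.seq (divBy (.add (input 0) (.const 1))) (.seq flagTest
    (.seq (assign 4 (reg 5)) (.seq (assign 5 (.const 0)) (incr 6)))))

theorem run_flagLoop (h0 : inp 0 = n) {W : ℕ} (hy : ρ.y = 0) (hi : ρ.i = 0) (hfl : ρ.fl = 0)
    (hV : ρ.V ≤ W) (hT : ρ.T ≤ W) (hW : 1 ≤ W) :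
    Run elem flagLoop (210 * (W * W)) (store inp n ρ f out)
      (store inp n { ρ with
        V := ρ.V / (n + 1) ^ ρ.T
        fl := digitFlag (n + 1) ρ.V (ρ.r + 1) ρ.T
        i := ρ.T } f out) := by
  obtain ⟨B, T, Z, r, V, y, i, j, v, fl, w, q, P⟩ := ρ
  dsimp only at *
  subst hy hi hfl
  have hloop := Run.loop (elem := elem) (a := reg 6) (b := reg 1)
    (p := .seq (divBy (.add (input 0) (.const 1))) (.seq flagTest
      (.seq (assign 4 (reg 5)) (.seq (assign 5 (.const 0)) (incr 6))))) (c := 50 * W + 130)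
    (fun t => store inp n ⟨B, T, Z, r, V / (n + 1) ^ t, 0, t, j, v,
      digitFlag (n + 1) V (r + 1) t, w, q, P⟩ f out) T
    (by
      intro t ht
      rw [eval_reg h0, eval_reg h0]
      exact ht)
    (by
      rw [eval_reg h0, eval_reg h0]
      exact lt_irrefl T)
    (fun t ht => by
      have e : V / (n + 1) ^ (t + 1) = V / (n + 1) ^ t / (n + 1) := by
        rw [pow_succ, Nat.div_div_eq_div_mul]
      have efl : digitFlag (n + 1) V (r + 1) (t + 1) =
          if V / (n + 1) ^ t % (n + 1) = r + 1 then 1 else digitFlag (n + 1) V (r + 1) t := by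
        split_ifs with h
        · exact digitFlag_succ_of_eq h
        · exact digitFlag_succ_of_ne h
      simp only [e, efl]
      refine Run.mono (Run.seq (run_divBy (d := n + 1) h0 (by omega) (by simp [NExp.cost])
        (fun V y => by simp only [NExp.eval, eval_input (show 0 < 4 by norm_num), h0]))
        (Run.seq (run_flagTest h0) (Run.seq
        (run_set h0 (x := V / (n + 1) ^ t / (n + 1)) (by norm_num) (by
          simp only [eval_reg h0, Regs.get]))
        (Run.seq (run_set h0 (x := 0) (by norm_num) rfl)
        (run_set h0 (x := t + 1) (by norm_num) (by
          simp only [NExp.eval, eval_reg h0, Regs.get, Regs.set])))))) ?_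
      simp only [NExp.cost, cost_reg]
      have : V / (n + 1) ^ t ≤ W := (Nat.div_le_self _ _).trans hV
      omega)
  simp only [pow_zero, Nat.div_one, digitFlag_zero] at hloop
  refine Run.mono hloop ?_
  simp only [cost_reg]
  have : T * (5 + 5 + (50 * W + 130) + 1) ≤ W * (50 * W + 141) :=
    Nat.mul_le_mul (by omega) (by omega)
  nlinarith

/-- The computation of the powers of `2` modulo `q`. -/
def residueLoop : Prog :=
  .while (reg 6) (reg 3) (.seq (assign 10 (.add (reg 10) (reg 10)))
    (.seq (.ite (reg 11) (.add (reg 10) (.const 1)) (assign 10 (.sub (reg 10) (reg 11))) .skip)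
      (incr 6)))

theorem run_residueLoop (h0 : inp 0 = n) {W : ℕ} (hi : ρ.i = 0) (hw : ρ.w = 1)
    (hr : ρ.r ≤ W) (hW : 1 ≤ W) :
    Run elem residueLoop (200 * (W * W)) (store inp n ρ f out)
      (store inp n { ρ with w := HittingSet.residue ρ.q ρ.r, i := ρ.r } f out) := by
  obtain ⟨B, T, Z, r, V, y, i, j, v, fl, w, q, P⟩ := ρ
  dsimp only at *
  subst hi hw
  have hloop := Run.loop (elem := elem) (a := reg 6) (b := reg 3)
    (p := .seq (assign 10 (.add (reg 10) (reg 10)))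
      (.seq (.ite (reg 11) (.add (reg 10) (.const 1)) (assign 10 (.sub (reg 10) (reg 11))) .skip)
      (incr 6))) (c := 70)
    (fun t => store inp n ⟨B, T, Z, r, V, y, t, j, v, fl, HittingSet.residue q t, q, P⟩ f out) r
    (by
      intro t ht
      rw [eval_reg h0, eval_reg h0]
      exact ht)
    (by
      rw [eval_reg h0, eval_reg h0]
      exact lt_irrefl r)
    (fun t ht => by
      set x := HittingSet.residue q t with hx
      have hx' : HittingSet.residue q (t + 1) = if q < x + x + 1 then x + x - q else x + x := rfl
      have h1 : Run elem (assign 10 (.add (reg 10) (reg 10))) 16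
          (store inp n ⟨B, T, Z, r, V, y, t, j, v, fl, x, q, P⟩ f out)
          (store inp n ⟨B, T, Z, r, V, y, t, j, v, fl, x + x, q, P⟩ f out) :=
        run_set h0 (by norm_num) (by simp only [NExp.eval, eval_reg h0, Regs.get])
      have h2 : ∀ z, Run elem (incr 6) 12
          (store inp n ⟨B, T, Z, r, V, y, t, j, v, fl, z, q, P⟩ f out)
          (store inp n ⟨B, T, Z, r, V, y, t + 1, j, v, fl, z, q, P⟩ f out) := fun z =>
        run_set h0 (by norm_num) (by simp only [NExp.eval, eval_reg h0, Regs.get])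
      simp only [hx']
      refine Run.mono (Run.seq h1 (Run.seq (t := 30) ?_ (h2 _))) (by norm_num)
      by_cases h : q < x + x + 1
      · rw [if_pos h]
        refine Run.mono (Run.ite_true (by
          simpa only [NExp.eval, eval_reg h0, Regs.get] using h) (run_set h0 (by norm_num) (by
          simp only [NExp.eval, eval_reg h0, Regs.get]))) (by simp [NExp.cost])
      · rw [if_neg h]
        exact Run.mono (Run.ite_false (by
          simpa only [NExp.eval, eval_reg h0, Regs.get] using h) (Run.skip _)) (by simp [NExp.cost]))
  refine Run.mono hloop ?_
  simp only [cost_reg]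
  have : r * (5 + 5 + 70 + 1) ≤ W * 81 := Nat.mul_le_mul (by omega) (by omega)
  nlinarith

/-- The power of the listed field element with number `v` and exponent `w`. -/
def powerLoop : Prog :=
  .while (reg 6) (reg 10) (.seq (.setF (.const 0) (.mul (.read (.const 0)) (.elem (reg 8))))
    (incr 6))

theorem run_powerLoop (h0 : inp 0 = n) {W : ℕ} (hi : ρ.i = 0) (hw : ρ.w ≤ W) (hW : 1 ≤ W) :
    Run elem powerLoop (200 * (W * W)) (store inp n ρ 1 out)
      (store inp n { ρ with i := ρ.w } (elem ρ.v ^ ρ.w) out) := by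
  obtain ⟨B, T, Z, r, V, y, i, j, v, fl, w, q, P⟩ := ρ
  dsimp only at *
  subst hi
  have hloop := Run.loop (elem := elem) (a := reg 6) (b := reg 10)
    (p := .seq (.setF (.const 0) (.mul (.read (.const 0)) (.elem (reg 8)))) (incr 6)) (c := 40)
    (fun t => store inp n ⟨B, T, Z, r, V, y, t, j, v, fl, w, q, P⟩ (elem v ^ t) out) w
    (by
      intro t ht
      rw [eval_reg h0, eval_reg h0]
      exact ht)
    (by
      rw [eval_reg h0, eval_reg h0]
      exact lt_irrefl w)
    (fun t ht => by
      refine Run.mono (Run.seq (run_setF (g := elem v ^ (t + 1)) (by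
        simp only [FExp.eval, eval_reg h0, Regs.get, NExp.eval, pow_succ]
        rfl)) (run_set h0 (x := t + 1) (by norm_num) (by
          simp only [NExp.eval, eval_reg h0, Regs.get]))) ?_
      simp [NExp.cost, FExp.cost])
  simp only [pow_zero] at hloop
  refine Run.mono hloop ?_
  simp only [cost_reg]
  have : w * (5 + 5 + 40 + 1) ≤ W * 51 := Nat.mul_le_mul (by omega) (by omega)
  nlinarith

end Subroutines

end FieldRAM

/-! ### Decoding a number and printing one coordinate. -/

namespace FieldRAM

section Coordinate

variable {K : Type*} [Field K] {elem : ℕ → K} {inp : ℕ → ℕ} {n : ℕ}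

/-- Decoding of the number `Z`: the modulus, the number of the value of the shift variable of the
base set of `x r`, and the code of a set of variables. -/
def decode : Prog :=
  .seq (assign 4 (reg 2)) (.seq (divBy (reg 0)) (.seq (assign 11 (.add (reg 4) (.const 1)))
  (.seq (assign 4 (reg 5)) (.seq (assign 5 (.const 0))
  (.seq (dropDigits (.read (.add (.const 4) (reg 3)))) (.seq (divBy (reg 0))
  (.seq (assign 8 (reg 4)) (.seq (assign 4 (reg 5)) (.seq (assign 5 (.const 0))
  (.seq (incr 6) (dropDigits (input 1))))))))))))

theorem run_decode (h0 : inp 0 = n) {B T Z r b m W : ℕ} (hr : r < n) (h1 : inp 1 = m)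
    (hb : inp (4 + r) = b) (hbm : b < m) (hB : 0 < B) (hZ : Z ≤ W) (hm : m ≤ W) (hW : 1 ≤ W)
    (out : List K) :
    Run elem decode (700 * (W * W)) (store inp n ⟨B, T, Z, r, 0, 0, 0, 0, 0, 0, 0, 0, 0⟩ 0 out)
      (store inp n ⟨B, T, Z, r, Z / B / B ^ m, 0, m, 0, Z / B / B ^ b % B, 0, 0, Z % B + 1, 0⟩
        0 out) := by
  have hbase : ∀ V y i, (NExp.read (.add (.const 4) (reg 3))).eval
      (store inp n ⟨B, T, Z, r, V, y, i, 0, 0, 0, 0, Z % B + 1, 0⟩ (0 : K) out).mem = b := by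
    intro V y i
    simp only [NExp.eval, eval_reg h0, Regs.get]
    rw [← hb]
    exact if_pos (by omega)
  -- The digits are removed in stages: `b` of them, then the one that is kept in register `v`, then
  -- the remaining `m - (b + 1)`.
  have e : Z / B / B ^ m = Z / B / B ^ b / B / B ^ (m - (b + 1)) := by
    rw [Nat.div_div_eq_div_mul _ (B ^ b), Nat.div_div_eq_div_mul _ _ (B ^ (m - (b + 1))),
      ← pow_succ, ← pow_add, show b + 1 + (m - (b + 1)) = m by omega]
  have hX : Z / B ≤ W := (Nat.div_le_self _ _).trans hZ
  have hX' : Z / B / B ^ b ≤ W := (Nat.div_le_self _ _).trans hX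
  rw [e]
  refine Run.mono (Run.seq
    (run_set h0 (x := Z) (by norm_num) (by simp only [eval_reg h0, Regs.get])) <|
    Run.seq (run_divBy (d := B) h0 hB (by simp) (fun V y => by
      simp only [eval_reg h0, Regs.get, Regs.set])) <|
    Run.seq (run_set h0 (x := Z % B + 1) (by norm_num) (by
      simp only [NExp.eval, eval_reg h0, Regs.get, Regs.set])) <|
    Run.seq (run_set h0 (x := Z / B) (by norm_num) (by
      simp only [eval_reg h0, Regs.get, Regs.set])) <|
    Run.seq (run_set h0 (x := 0) (by norm_num) rfl) <|
    Run.seq (run_dropDigits (L := b) (W := W) h0 (by simp [NExp.cost])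
      (fun V i => hbase V 0 i) hB rfl (Nat.zero_le _) hX (by omega) hW) <|
    Run.seq (run_divBy (d := B) h0 hB (by simp) (fun V y => by
      simp only [eval_reg h0, Regs.get, Regs.set])) <|
    Run.seq (run_set h0 (x := Z / B / B ^ b % B) (by norm_num) (by
      simp only [eval_reg h0, Regs.get, Regs.set, Nat.sub_zero])) <|
    Run.seq (run_set h0 (x := Z / B / B ^ b / B) (by norm_num) (by
      simp only [eval_reg h0, Regs.get, Regs.set, Nat.sub_zero])) <|
    Run.seq (run_set h0 (x := 0) (by norm_num) rfl) <|
    Run.seq (run_set h0 (x := b + 1) (by norm_num) (by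
      simp only [NExp.eval, eval_reg h0, Regs.get, Regs.set])) <|
    run_dropDigits (L := m) (W := W) h0 (by simp)
      (fun V i => by rw [eval_input (by norm_num), h1]) hB rfl hbm
      ((Nat.div_le_self _ _).trans hX') hm hW) ?_
  simp only [NExp.cost, cost_reg, Regs.set, Nat.sub_zero]
  nlinarith

/-- The coordinate is computed from the decoded number and printed. -/
def printDecoded : Prog :=
  .seq (assign 6 (.const 0)) (.seq flagLoop (.seq (assign 10 (.const 1))
  (.seq (assign 6 (.const 0)) (.seq residueLoop (.seq (assign 6 (.const 0))
  (.seq (.setF (.const 0) .one) (.seq powerLoop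
  (.seq (.ite (.const 0) (reg 9) (.emit (.add (.read (.const 0)) .one)) (.emit (.read (.const 0))))
  (.seq (assign 4 (.const 0)) (.seq (assign 6 (.const 0)) (.seq (assign 8 (.const 0))
  (.seq (assign 9 (.const 0)) (.seq (assign 10 (.const 0)) (.seq (assign 11 (.const 0))
  (.setF (.const 0) .zero)))))))))))))))

/-- All working registers and the field cell return to zero, so that every coordinate starts from
the same state. -/
theorem run_printDecoded (h0 : inp 0 = n) {B T Z r V i v q W : ℕ} (hr : r ≤ W) (hV : V ≤ W)
    (hT : T ≤ W) (hq : 1 ≤ q) (hqW : q ≤ W) (hW : 1 ≤ W) (out : List K) :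
    Run elem printDecoded (900 * (W * W))
      (store inp n ⟨B, T, Z, r, V, 0, i, 0, v, 0, 0, q, 0⟩ 0 out)
      (store inp n ⟨B, T, Z, r, 0, 0, 0, 0, 0, 0, 0, 0, 0⟩ 0
        (out ++ [elem v ^ HittingSet.residue q r +
          if 0 < digitFlag (n + 1) V (r + 1) T then 1 else 0])) := by
  have hemit : ∀ (ρ : Regs) (g : K), ρ.fl = digitFlag (n + 1) V (r + 1) T →
      Run elem (.ite (.const 0) (reg 9) (.emit (.add (.read (.const 0)) .one))
        (.emit (.read (.const 0)))) 20 (store inp n ρ g out)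
      (store inp n ρ g (out ++ [g + if 0 < digitFlag (n + 1) V (r + 1) T then 1 else 0])) := by
    intro ρ g hfl
    have h9 : (reg 9).eval (store inp n ρ g out).mem = digitFlag (n + 1) V (r + 1) T := by
      simp only [eval_reg h0, Regs.get, hfl]
    by_cases h : 0 < digitFlag (n + 1) V (r + 1) T
    · rw [if_pos h]
      exact Run.mono (Run.ite_true (by rw [h9]; exact h) (run_emit rfl))
        (by simp [NExp.cost, FExp.cost])
    · rw [if_neg h, add_zero]
      exact Run.mono (Run.ite_false (by rw [h9]; exact h) (run_emit rfl))
        (by simp [NExp.cost, FExp.cost])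
  refine Run.mono (Run.seq (run_set h0 (x := 0) (by norm_num) rfl) <|
    Run.seq (run_flagLoop (W := W) h0 rfl rfl rfl hV hT hW) <|
    Run.seq (run_set h0 (x := 1) (by norm_num) rfl) <|
    Run.seq (run_set h0 (x := 0) (by norm_num) rfl) <|
    Run.seq (run_residueLoop (W := W) h0 rfl rfl hr hW) <|
    Run.seq (run_set h0 (x := 0) (by norm_num) rfl) <|
    Run.seq (run_setF (g := 1) rfl) <|
    Run.seq (run_powerLoop (W := W) h0 rfl ((HittingSet.residue_le hq r).trans hqW) hW) <|
    Run.seq (hemit _ _ rfl) <|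
    Run.seq (run_set h0 (x := 0) (by norm_num) rfl) <|
    Run.seq (run_set h0 (x := 0) (by norm_num) rfl) <|
    Run.seq (run_set h0 (x := 0) (by norm_num) rfl) <|
    Run.seq (run_set h0 (x := 0) (by norm_num) rfl) <|
    Run.seq (run_set h0 (x := 0) (by norm_num) rfl) <|
    Run.seq (run_set h0 (x := 0) (by norm_num) rfl) <|
    run_setF (g := 0) rfl) ?_
  simp only [NExp.cost, FExp.cost]
  nlinarith

end Coordinate

end FieldRAM

namespace FieldRAM

/-! ### The whole program -/

section Program

variable {K : Type*} [Field K] {elem : ℕ → K} {inp : ℕ → ℕ} {n : ℕ}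

/-- The coordinate `r` of the point with number `Z`. -/
noncomputable def coordinate (elem : ℕ → K) (inp : ℕ → ℕ) (n m B T Z r : ℕ) : K :=
  elem (Z / B / B ^ inp (4 + r) % B) ^ HittingSet.residue (Z % B + 1) r +
    if 0 < digitFlag (n + 1) (Z / B / B ^ m) (r + 1) T then 1 else 0

def printPoint : Prog :=
  .while (reg 3) (input 0) (.seq decode (.seq printDecoded (incr 3)))

theorem run_printPoint (h0 : inp 0 = n) {B T Z m W : ℕ} (h1 : inp 1 = m)
    (hb : ∀ r < n, inp (4 + r) < m) (hB : 0 < B) (hZ : Z ≤ W) (hm : m ≤ W) (hn : n ≤ W)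
    (hT : T ≤ W) (hBW : B ≤ W) (hW : 1 ≤ W) (out : List K) :
    Run elem printPoint (1700 * (W * (W * W)))
      (store inp n ⟨B, T, Z, 0, 0, 0, 0, 0, 0, 0, 0, 0, 0⟩ 0 out)
      (store inp n ⟨B, T, Z, n, 0, 0, 0, 0, 0, 0, 0, 0, 0⟩ 0
        (out ++ (List.range n).map (coordinate elem inp n m B T Z))) := by
  have hloop := Run.loop (elem := elem) (a := reg 3) (b := input 0)
    (p := .seq decode (.seq printDecoded (incr 3))) (c := 1600 * (W * W) + 14)
    (fun r => store inp n ⟨B, T, Z, r, 0, 0, 0, 0, 0, 0, 0, 0, 0⟩ 0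
        (out ++ (List.range r).map (coordinate elem inp n m B T Z))) n
    (by
      intro r hr
      rw [eval_reg h0, eval_input (by norm_num), h0]
      exact hr)
    (by
      rw [eval_reg h0, eval_input (by norm_num), h0]
      exact lt_irrefl n)
    (fun r hr => by
      have hX : Z / B / B ^ m ≤ W :=
        ((Nat.div_le_self _ _).trans (Nat.div_le_self _ _)).trans hZ
      have hmod := Nat.mod_lt Z hB
      simp only [List.range_succ, List.map_append, List.map_cons, List.map_nil,
        ← List.append_assoc]
      refine Run.mono (Run.seq
        (run_decode (b := inp (4 + r)) h0 hr h1 rfl (hb r hr) hB hZ hm hW _) <|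
        Run.seq (run_printDecoded h0 (by omega) hX hT (Nat.succ_pos _) (by omega) hW _)
        (run_set h0 (x := r + 1) (by norm_num) (by
          simp only [NExp.eval, eval_reg h0, Regs.get]))) ?_
      simp only [NExp.cost, cost_reg]
      omega)
  simp only [List.range_zero, List.map_nil, List.append_nil] at hloop
  refine Run.mono hloop ?_
  simp only [cost_reg, cost_input]
  have hS : 1 ≤ W * W := Nat.mul_pos hW hW
  have hS' : 1 ≤ W * (W * W) := Nat.mul_pos hW hS
  have : n * (5 + 2 + (1600 * (W * W) + 14) + 1) ≤ W * (1622 * (W * W)) :=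
    Nat.mul_le_mul hn (by omega)
  nlinarith

def printPoints : Prog :=
  .while (reg 2) (reg 1) (.seq printPoint (.seq (assign 3 (.const 0)) (incr 2)))

theorem run_printPoints (h0 : inp 0 = n) {B T m W : ℕ} (h1 : inp 1 = m)
    (hb : ∀ r < n, inp (4 + r) < m) (hB : 0 < B) (hm : m ≤ W) (hn : n ≤ W)
    (hT : T ≤ W) (hBW : B ≤ W) (hW : 1 ≤ W) :
    Run elem printPoints (1800 * (W * (W * (W * W))))
      (store inp n ⟨B, T, 0, 0, 0, 0, 0, 0, 0, 0, 0, 0, 0⟩ 0 [])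
      (store inp n ⟨B, T, T, 0, 0, 0, 0, 0, 0, 0, 0, 0, 0⟩ 0
        ((List.range T).flatMap fun Z => (List.range n).map (coordinate elem inp n m B T Z))) := by
  have hloop := Run.loop (elem := elem) (a := reg 2) (b := reg 1)
    (p := .seq printPoint (.seq (assign 3 (.const 0)) (incr 2))) (c := 1700 * (W * (W * W)) + 20)
    (fun Z => store inp n ⟨B, T, Z, 0, 0, 0, 0, 0, 0, 0, 0, 0, 0⟩ 0
      ((List.range Z).flatMap fun Z => (List.range n).map (coordinate elem inp n m B T Z))) T
    (by
      intro r hr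
      rw [eval_reg h0, eval_reg h0]
      exact hr)
    (by
      rw [eval_reg h0, eval_reg h0]
      exact lt_irrefl T)
    (fun Z hZ => by
      simp only [List.range_succ, List.flatMap_append, List.flatMap_cons, List.flatMap_nil,
        List.append_nil]
      refine Run.mono (Run.seq
        (run_printPoint h0 h1 hb hB (by omega) hm hn hT hBW hW _) <|
        Run.seq (run_set h0 (x := 0) (by norm_num) rfl)
        (run_set h0 (x := Z + 1) (by norm_num) (by
          simp only [NExp.eval, eval_reg h0, Regs.get, Regs.set]))) ?_
      simp only [NExp.cost, cost_reg]
      omega)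
  simp only [List.range_zero, List.flatMap_nil] at hloop
  refine Run.mono hloop ?_
  simp only [cost_reg]
  have hS : 1 ≤ W * (W * W) := Nat.mul_pos hW (Nat.mul_pos hW hW)
  have hS' : 1 ≤ W * (W * (W * W)) := Nat.mul_pos hW hS
  have : T * (5 + 5 + (1700 * (W * (W * W)) + 20) + 1) ≤ W * (1731 * (W * (W * W))) :=
    Nat.mul_le_mul hT (by omega)
  nlinarith

/-- The product of the values of `D` and `E`, in register `y`. -/
def product (D E : NExp) : Prog :=
  .seq (assign 5 (.const 0)) (.seq (assign 7 (.const 0))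
    (.while (reg 7) E (.seq (assign 5 (.add (reg 5) D)) (incr 7))))

theorem run_product (h0 : inp 0 = n) {ρ : Regs} {f : K} {out : List K} {D E : NExp} {d e : ℕ}
    (hcD : D.cost ≤ 5) (hcE : E.cost ≤ 5)
    (hD : ∀ y j, D.eval (store inp n { ρ with y := y, j := j } f out).mem = d)
    (hE : ∀ y j, E.eval (store inp n { ρ with y := y, j := j } f out).mem = e) :
    Run elem (product D E) (50 * e + 50) (store inp n ρ f out)
      (store inp n { ρ with y := d * e, j := e } f out) := by
  have hloop := Run.loop (elem := elem) (a := reg 7) (b := E)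
    (p := .seq (assign 5 (.add (reg 5) D)) (incr 7)) (c := 29)
    (fun t => store inp n { ρ with y := d * t, j := t } f out) e
    (by
      intro t ht
      rw [hE, eval_reg h0]
      exact ht)
    (by
      rw [hE, eval_reg h0]
      exact lt_irrefl e)
    (fun t ht => by
      refine Run.mono (Run.seq
        (run_set h0 (x := d * (t + 1)) (by norm_num) (by
          simp only [NExp.eval, eval_reg h0, Regs.get, hD, mul_add, mul_one]))
        (run_set h0 (x := t + 1) (by norm_num) (by
          simp only [NExp.eval, eval_reg h0, Regs.get, Regs.set]))) ?_
      simp only [NExp.cost, cost_reg]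
      omega)
  refine Run.mono (Run.seq (run_set h0 (x := 0) (by norm_num) rfl)
    (Run.seq (run_set h0 (x := 0) (by norm_num) rfl) hloop)) ?_
  simp only [NExp.cost, cost_reg]
  have : e * (5 + E.cost + 29 + 1) ≤ e * 50 := Nat.mul_le_mul_left _ (by omega)
  omega

def powerStep : Prog :=
  .seq (product (reg 0) (.add (input 0) (.const 1))) (.seq (assign 0 (reg 5))
    (.seq (assign 5 (.const 0)) (.seq (assign 7 (.const 0)) (incr 6))))

/-- Multiplication of `B` by `(n + 1) ^ (5 * δ)`. -/
def powerSteps : Prog :=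
  .while (reg 6) (.add (input 2) (.add (input 2) (.add (input 2) (.add (input 2) (input 2)))))
    powerStep

theorem run_powerSteps (h0 : inp 0 = n) {δ B P W : ℕ} (h2 : inp 2 = δ) (hn : n + 1 ≤ W)
    (hδ : 5 * δ ≤ W) :
    Run elem powerSteps (200 * (W * W))
      (store inp n ⟨B, 0, 0, 0, 0, 0, 0, 0, 0, 0, 0, 0, P⟩ 0 [])
      (store inp n ⟨B * (n + 1) ^ (5 * δ), 0, 0, 0, 0, 0, 5 * δ, 0, 0, 0, 0, 0, P⟩ 0 []) := by
  have hlim : ∀ ρ : Regs, (NExp.add (input 2) (.add (input 2) (.add (input 2)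
      (.add (input 2) (input 2))))).eval (store inp n ρ (0 : K) []).mem = 5 * δ := by
    intro ρ
    simp only [NExp.eval, eval_input (show 2 < 4 by norm_num), h2]
    omega
  have hloop := Run.loop (elem := elem) (a := reg 6)
    (b := .add (input 2) (.add (input 2) (.add (input 2) (.add (input 2) (input 2)))))
    (p := powerStep) (c := 50 * W + 100)
    (fun t => store inp n ⟨B * (n + 1) ^ t, 0, 0, 0, 0, 0, t, 0, 0, 0, 0, 0, P⟩ 0 []) (5 * δ)
    (by
      intro t ht
      rw [hlim, eval_reg h0]
      exact ht)
    (by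
      rw [hlim, eval_reg h0]
      exact lt_irrefl (5 * δ))
    (fun t ht => by
      simp only [pow_succ, ← mul_assoc]
      refine Run.mono (Run.seq (run_product (d := B * (n + 1) ^ t) (e := n + 1) h0 (by simp)
          (by simp [NExp.cost]) (fun y j => by simp only [eval_reg h0, Regs.get])
          (fun y j => by simp only [NExp.eval, eval_input (show 0 < 4 by norm_num), h0])) <|
        Run.seq (run_set h0 (x := B * (n + 1) ^ t * (n + 1)) (by norm_num) (by
          simp only [eval_reg h0, Regs.get])) <|
        Run.seq (run_set h0 (x := 0) (by norm_num) rfl) <|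
        Run.seq (run_set h0 (x := 0) (by norm_num) rfl)
        (run_set h0 (x := t + 1) (by norm_num) (by
          simp only [NExp.eval, eval_reg h0, Regs.get, Regs.set]))) ?_
      simp only [NExp.cost, cost_reg]
      omega)
  simp only [pow_zero, mul_one] at hloop
  refine Run.mono hloop ?_
  simp only [NExp.cost, cost_reg, cost_input]
  have : 5 * δ * (5 + (2 + (2 + (2 + (2 + 2 + 1) + 1) + 1) + 1) + (50 * W + 100) + 1) ≤
      W * (50 * W + 120) := Nat.mul_le_mul hδ (by omega)
  nlinarith

/-- The computation of `B = (n + 1) ^ (5 * δ * ⌈log₂ (k + 1)⌉)`. -/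
def computeBase : Prog :=
  .seq (assign 12 (.const 1)) (.seq (assign 0 (.const 1))
    (.seq (.while (reg 12) (.add (input 3) (.const 1)) (.seq (assign 12 (.add (reg 12) (reg 12)))
      (.seq powerSteps (assign 6 (.const 0)))))
    (assign 12 (.const 0))))

/-- Register `P` is `2 ^ t` after `t` rounds, so the test against `k + 1` stops the loop after
exactly `Nat.clog 2 (k + 1)` rounds without computing a logarithm. -/
theorem run_computeBase (h0 : inp 0 = n) {δ k W : ℕ} (h2 : inp 2 = δ) (h3 : inp 3 = k)
    (hn : n + 1 ≤ W) (hδ : 5 * δ ≤ W) (hl : Nat.clog 2 (k + 1) ≤ W) (hW : 1 ≤ W) :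
    Run elem computeBase (300 * (W * (W * W)))
      (store inp n ⟨0, 0, 0, 0, 0, 0, 0, 0, 0, 0, 0, 0, 0⟩ 0 [])
      (store inp n ⟨(n + 1) ^ (5 * (δ * Nat.clog 2 (k + 1))), 0, 0, 0, 0, 0, 0, 0, 0, 0, 0, 0, 0⟩
        0 []) := by
  have hlim : ∀ ρ : Regs, (NExp.add (input 3) (.const 1)).eval
      (store inp n ρ (0 : K) []).mem = k + 1 := by
    intro ρ
    simp only [NExp.eval, eval_input (show 3 < 4 by norm_num), h3]
  have hloop := Run.loop (elem := elem) (a := reg 12) (b := .add (input 3) (.const 1))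
    (p := .seq (assign 12 (.add (reg 12) (reg 12))) (.seq powerSteps (assign 6 (.const 0))))
    (c := 200 * (W * W) + 30)
    (fun t => store inp n
      ⟨(n + 1) ^ (5 * δ * t), 0, 0, 0, 0, 0, 0, 0, 0, 0, 0, 0, 2 ^ t⟩ 0 []) (Nat.clog 2 (k + 1))
    (by
      intro t ht
      rw [hlim, eval_reg h0]
      by_contra hle
      exact absurd ((Nat.clog_le_iff_le_pow one_lt_two).2 (not_lt.1 hle)) (by omega))
    (by
      rw [hlim, eval_reg h0]
      exact not_lt.2 (Nat.le_pow_clog one_lt_two _))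
    (fun t ht => by
      simp only [mul_add, mul_one, pow_add, pow_succ 2 t, mul_two (2 ^ t)]
      refine Run.mono (Run.seq (run_set h0 (x := 2 ^ t + 2 ^ t) (by norm_num) (by
          simp only [NExp.eval, eval_reg h0, Regs.get])) <|
        Run.seq (run_powerSteps h0 h2 hn hδ) (run_set h0 (x := 0) (by norm_num) rfl)) ?_
      simp only [NExp.cost, cost_reg]
      omega)
  simp only [pow_zero, mul_zero, mul_assoc] at hloop
  refine Run.mono (Run.seq (run_set h0 (x := 1) (by norm_num) rfl) <|
    Run.seq (run_set h0 (x := 1) (by norm_num) rfl) <|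
    Run.seq hloop (run_set h0 (x := 0) (by norm_num) rfl)) ?_
  simp only [NExp.cost, cost_reg, cost_input]
  have hS : 1 ≤ W * W := Nat.mul_pos hW hW
  have hS' : 1 ≤ W * (W * W) := Nat.mul_pos hW hS
  have : Nat.clog 2 (k + 1) * (5 + (2 + 1 + 1) + (200 * (W * W) + 30) + 1) ≤
      W * (240 * (W * W)) := Nat.mul_le_mul hl (by omega)
  nlinarith

/-- The computation of `T = B ^ (2 * m + 1)`. -/
def computeBound : Prog :=
  .seq (assign 1 (reg 0)) (.seq (.while (reg 6) (.add (input 1) (input 1))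
    (.seq (product (reg 1) (reg 0)) (.seq (assign 1 (reg 5))
    (.seq (assign 5 (.const 0)) (.seq (assign 7 (.const 0)) (incr 6))))))
    (assign 6 (.const 0)))

theorem run_computeBound (h0 : inp 0 = n) {m B W : ℕ} (h1 : inp 1 = m) (hB : B ≤ W)
    (hm : 2 * m ≤ W) (hW : 1 ≤ W) :
    Run elem computeBound (300 * (W * (W * W)))
      (store inp n ⟨B, 0, 0, 0, 0, 0, 0, 0, 0, 0, 0, 0, 0⟩ 0 [])
      (store inp n ⟨B, B ^ (2 * m + 1), 0, 0, 0, 0, 0, 0, 0, 0, 0, 0, 0⟩ (0 : K) []) := by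
  have hlim : ∀ ρ : Regs, (NExp.add (input 1) (input 1)).eval
      (store inp n ρ (0 : K) []).mem = 2 * m := by
    intro ρ
    simp only [NExp.eval, eval_input (show 1 < 4 by norm_num), h1]
    omega
  have hloop := Run.loop (elem := elem) (a := reg 6) (b := .add (input 1) (input 1))
    (p := .seq (product (reg 1) (reg 0)) (.seq (assign 1 (reg 5))
      (.seq (assign 5 (.const 0)) (.seq (assign 7 (.const 0)) (incr 6))))) (c := 50 * W + 100)
    (fun t => store inp n ⟨B, B ^ (t + 1), 0, 0, 0, 0, t, 0, 0, 0, 0, 0, 0⟩ 0 []) (2 * m)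
    (by
      intro t ht
      rw [hlim, eval_reg h0]
      exact ht)
    (by
      rw [hlim, eval_reg h0]
      exact lt_irrefl (2 * m))
    (fun t ht => by
      simp only [pow_succ B (t + 1)]
      refine Run.mono (Run.seq (run_product (d := B ^ (t + 1)) (e := B) h0 (by simp)
          (by simp) (fun y j => by simp only [eval_reg h0, Regs.get])
          (fun y j => by simp only [eval_reg h0, Regs.get])) <|
        Run.seq (run_set h0 (x := B ^ (t + 1) * B) (by norm_num) (by
          simp only [eval_reg h0, Regs.get])) <|
        Run.seq (run_set h0 (x := 0) (by norm_num) rfl) <|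
        Run.seq (run_set h0 (x := 0) (by norm_num) rfl)
        (run_set h0 (x := t + 1) (by norm_num) (by
          simp only [NExp.eval, eval_reg h0, Regs.get, Regs.set]))) ?_
      simp only [NExp.cost, cost_reg]
      omega)
  simp only [zero_add, pow_one] at hloop
  refine Run.mono (Run.seq (run_set h0 (x := B) (by norm_num) (by
      simp only [eval_reg h0, Regs.get])) <|
    Run.seq hloop (run_set h0 (x := 0) (by norm_num) rfl)) ?_
  simp only [NExp.cost, cost_reg, cost_input]
  have hS : 1 ≤ W * W := Nat.mul_pos hW hW
  have : 2 * m * (5 + (2 + 2 + 1) + (50 * W + 100) + 1) ≤ W * (50 * W + 111) :=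
    Nat.mul_le_mul hm (by omega)
  have h3 : W * W ≤ W * (W * W) := Nat.le_mul_of_pos_left _ hW
  nlinarith

/-- The program that prints the hitting set. -/
def hittingSetProg : Prog := .seq computeBase (.seq computeBound printPoints)

theorem store_initState {m : ℕ} (δ k : ℕ) (base : Fin n → Fin m) :
    initState K δ k base = store (initState K δ k base).mem n
      ⟨0, 0, 0, 0, 0, 0, 0, 0, 0, 0, 0, 0, 0⟩ 0 [] := by
  have hget : ∀ a, (⟨0, 0, 0, 0, 0, 0, 0, 0, 0, 0, 0, 0, 0⟩ : Regs).get a = 0 := by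
    intro a
    unfold Regs.get
    split <;> rfl
  simp only [store, hget, ite_self]
  conv_lhs => rw [initState]
  simp only [State.mk.injEq, and_true]
  funext a
  by_cases h : a < n + 4
  · rw [if_pos h]; rfl
  · rw [if_neg h, if_neg (by omega), if_neg (by omega), if_neg (by omega), if_neg (by omega),
      dif_neg (by omega)]

/-- The machine inspects only `T` digits of the code. This loses nothing: the code is at most `Z <
T`, so all later digits are `0`, and `0` is never `r + 1`. -/
theorem coordinate_initState {m : ℕ} (δ k : ℕ) (base : Fin n → Fin m) {B T Z : ℕ} (hZ : Z < T)
    (r : Fin n) : coordinate elem (initState K δ k base).mem n m B T Z r =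
      HittingSet.point elem base B Z r := by
  have hbase : (initState K δ k base).mem (4 + r) = base r := by
    have h : 4 + (r : ℕ) - 4 < n := by omega
    simp only [initState]
    rw [if_neg (by omega), if_neg (by omega), if_neg (by omega), if_neg (by omega), dif_pos h]
    congr 3
    omega
  rw [coordinate, HittingSet.point, hbase]
  congr 1
  have : 0 < digitFlag (n + 1) (Z / B / B ^ m) (r + 1) T ↔
      ∃ j, Z / B / B ^ m / (n + 1) ^ j % (n + 1) = r + 1 := by
    rw [digitFlag]
    constructor
    · intro h
      split_ifs at h with h1
      · obtain ⟨j, _, hj⟩ := h1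
        exact ⟨j, hj⟩
      · omega
    · rintro ⟨j, hj⟩
      rw [if_pos]
      · exact one_pos
      · refine ⟨j, ?_, hj⟩
        by_contra hle
        have hr : 0 < n := r.pos
        have h1 : Z / B / B ^ m ≤ Z := (Nat.div_le_self _ _).trans (Nat.div_le_self _ _)
        have h2 : j < (n + 1) ^ j := Nat.lt_pow_self (by omega)
        rw [Nat.div_eq_of_lt (by omega)] at hj
        simp at hj
  by_cases h : ∃ j, Z / B / B ^ m / (n + 1) ^ j % (n + 1) = r + 1
  · rw [if_pos h, if_pos (this.2 h)]
  · rw [if_neg h, if_neg (mt this.1 h)]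

/-- `W` bounds every quantity that controls a loop. The dominant cost is at most `W` points with at
most `W` coordinates, each printed in `O(W ^ 2)` steps. -/
theorem hittingSetProg_prints {m δ k B T W : ℕ} (base : Fin n → Fin m)
    (hB : B = (n + 1) ^ (5 * (δ * Nat.clog 2 (k + 1)))) (hT : T = B ^ (2 * m + 1))
    (hnW : n + 1 ≤ W) (hδW : 5 * δ ≤ W) (hlW : Nat.clog 2 (k + 1) ≤ W) (hmW : 2 * m ≤ W)
    (hTW : T ≤ W) :
    ∃ t ≤ 2500 * (W * (W * (W * W))), Prints elem hittingSetProg δ k base t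
      ((List.range T).map fun Z => HittingSet.point elem base B Z) := by
  have hW : 1 ≤ W := by omega
  have hB0 : 0 < B := by rw [hB]; positivity
  have hBW : B ≤ W := (by rw [hT]; exact Nat.le_self_pow (by omega) B : B ≤ T).trans hTW
  set inp := (initState K δ k base).mem with hinp
  have h0 : inp 0 = n := rfl
  have h1 : inp 1 = m := rfl
  have h2 : inp 2 = δ := rfl
  have h3 : inp 3 = k := rfl
  have hb : ∀ r < n, inp (4 + r) < m := by
    intro r hr
    have h : 4 + r - 4 < n := by omega
    simp only [hinp, initState]
    rw [if_neg (by omega), if_neg (by omega), if_neg (by omega), if_neg (by omega), dif_pos h]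
    exact (base _).2
  have hrun := Run.seq (run_computeBase (K := K) (elem := elem) h0 h2 h3 hnW hδW hlW hW)
    (Run.seq (run_computeBound h0 h1 (hB ▸ hBW) hmW hW)
      (run_printPoints h0 h1 hb (by positivity) (by omega) (by omega)
        (by rw [← hB, ← hT]; exact hTW) (hB ▸ hBW) hW))
  rw [← store_initState, ← hB, ← hT] at hrun
  obtain ⟨t, ht, he⟩ := hrun
  refine ⟨t, ht.trans ?_, _, he, ?_⟩
  · have hS : W * (W * W) ≤ W * (W * (W * W)) := Nat.le_mul_of_pos_left _ hW
    have hS' : 1 ≤ W * (W * (W * W)) :=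
      Nat.mul_pos hW (Nat.mul_pos hW (Nat.mul_pos hW hW))
    omega
  · simp only [store, List.flatMap_map]
    refine List.flatMap_congr fun Z hZ => ?_
    rw [List.ofFn_eq_map, ← List.map_coe_finRange_eq_range, List.map_map]
    refine List.map_congr_left fun r _ => ?_
    exact coordinate_initState δ k base (List.mem_range.1 hZ) r

end Program

end FieldRAM

theorem theorem2 :
    -- the hitting-set and its running time
    (∃ (p : FieldRAM.Prog) (c : ℕ),
      ∀ (K : Type v) [Field K] (elem : ℕ → K) (n m δ k : ℕ) (base : Fin n → Fin m),
        1 ≤ n → 1 ≤ δ → 1 ≤ k →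
        Set.InjOn elem (Set.Iio ((n + 1) ^ (c * (δ * Nat.clog 2 (k + 1))))) →
        ∃ (t : ℕ) (H : List (Fin n → K)),
          FieldRAM.Prints elem p δ k base t H ∧
          t ≤ (n + 1) ^ (c * (m * δ * Nat.clog 2 (k + 1))) ∧
          ∀ (F : Type u) [Field F] [Algebra F K] (Q : Depth3Circuit F n k),
            Q.IsMultilinear → Q.HasBaseSetsDistance base δ → Q.poly ≠ 0 →
            ∃ x ∈ H, MvPolynomial.aeval x Q.poly ≠ 0) ∧
    -- the concentration after the shift
    (∀ (F : Type u) [Field F] (n m δ k : ℕ) (base : Fin n → Fin m) (w : Fin n → ℕ)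
      (Q : Depth3Circuit F n k), 1 ≤ δ → 1 ≤ k →
        Q.IsMultilinear → Q.HasBaseSetsDistance base δ →
        SeparatesBaseSets base w (δ * Nat.clog 2 (k + 1)) →
        IsConcentrated (Q.shiftedGate base w)
          (m * ((Nat.clog 2 (k + 1) + δ + 1) - 1) + 1)) := by
  -- With `r = m * (δ * l)` one has `B ^ (2 * m + 1) ≤ (n + 1) ^ (15 * r) = W`, and `2500 * W ^ 4 ≤
  -- W ^ 5 = (n + 1) ^ (75 * r)`.
  refine ⟨⟨FieldRAM.hittingSetProg, 75, ?_⟩, ?_⟩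
  · intro K _ elem n m δ k base hn hδ hk helem
    -- The existence of a variable forces at least one base set.
    have hm : 1 ≤ m := (base ⟨0, hn⟩).pos
    have hl : 1 ≤ Nat.clog 2 (k + 1) := Nat.clog_pos (by norm_num) (by omega)
    set l := Nat.clog 2 (k + 1) with hl_def
    have hs : 1 ≤ δ * l := Nat.mul_pos hδ hl
    have hr : 1 ≤ m * (δ * l) := Nat.mul_pos hm hs
    have hδs : δ ≤ m * (δ * l) :=
      (Nat.le_mul_of_pos_right δ hl).trans (Nat.le_mul_of_pos_left _ hm)
    have hls : l ≤ m * (δ * l) :=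
      (Nat.le_mul_of_pos_left l hδ).trans (Nat.le_mul_of_pos_left _ hm)
    have hms : m ≤ m * (δ * l) := Nat.le_mul_of_pos_right m hs
    set r := m * (δ * l) with hr_def
    have hpow : ∀ {a b : ℕ}, a ≤ b → (n + 1) ^ a ≤ (n + 1) ^ b :=
      fun h => Nat.pow_le_pow_right (by omega) h
    have hlt : ∀ {a : ℕ}, a ≤ 15 * r → a ≤ (n + 1) ^ (15 * r) := fun h =>
      (Nat.lt_pow_self (by omega) : _ < (n + 1) ^ _).le.trans (hpow h)
    obtain ⟨t, ht, hprints⟩ := FieldRAM.hittingSetProg_prints (K := K) (elem := elem) (δ := δ)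
      (k := k) (W := (n + 1) ^ (15 * r)) base rfl rfl
      (by simpa using hpow (show 1 ≤ 15 * r by omega)) (hlt (by omega)) (hlt (by omega))
      (hlt (by omega)) (by
        rw [← pow_mul]
        refine hpow ?_
        have : δ * l ≤ r := Nat.le_mul_of_pos_left _ hm
        calc 5 * (δ * l) * (2 * m + 1) = 10 * r + 5 * (δ * l) := by rw [hr_def]; ring
          _ ≤ 15 * r := by omega)
    refine ⟨t, _, hprints, ht.trans ?_, ?_⟩
    · have hc : 2500 ≤ (n + 1) ^ (15 * r) :=
        calc 2500 ≤ 2 ^ 15 := by norm_num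
          _ ≤ (n + 1) ^ 15 := Nat.pow_le_pow_left (by omega) _
          _ ≤ (n + 1) ^ (15 * r) := hpow (by omega)
      refine (Nat.mul_le_mul_right _ hc).trans (le_of_eq ?_)
      rw [mul_assoc m, ← hr_def]
      ring
    · intro F _ _ Q hml hQ h0
      obtain ⟨Z, hZ, hne⟩ := Q.exists_point_ne_zero rfl
        (helem.mono (Set.Iio_subset_Iio
          (hpow (Nat.mul_le_mul_right _ (by norm_num : 5 ≤ 75))))) hn hk hδ hml hQ h0
      exact ⟨_, List.mem_map.2 ⟨Z, List.mem_range.2 hZ, rfl⟩, hne⟩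
  · intro F _ n m δ k base w Q hδ _ hml hQ hw
    exact Depth3Circuit.isConcentrated_shiftedGate hδ hQ hw
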